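/- Throughout, functions on $\mathbb R^N$ are complex valued, $C_0(\mathbb R^N)$ is the space of continuous functions vanishing at infinity with the sup norm, $C_c^\infty(\mathbb R^N)$ is the space of smooth compactly supported functions, $e^{t\Delta}$ is the heat semigroup, and $H^s(\mathbb R^N)$, $s\ge 0$, is the usual Sobolev space with norm $\|f\|_{H^s}=\|\mathcal F^{-1}[(1+|\xi|^2)^{s/2}\hat f\,]\|_{L^2}$. For $\alpha>0$, $\lambda\in\mathbb C$ and $\varphi\in C_0(\mathbb R^N)$ consider the Cauchy problem $$u_t=\Delta u+\lambda|u|^\alpha u,\qquad u(0,\cdot)=\varphi .\tag{NLH}$$ A solution on $[0,T)$ is a function $u\in C([0,T),C_0(\mathbb R^N))$ such that $$u(t)=e^{t\Delta}\varphi+\lambda\int_0^t e^{(t-\sigma)\Delta}\bigl(|u(\sigma)|^\alpha u(\sigma)\bigr)\,d\sigma\qquad(0\le t<T).$$ Let $T_{\max}(\varphi)\in(0,\infty]$ be the maximal existence time, that is, the supremum of all $T$ for which there is a solution on $[0,T)$; the corresponding solution of (NLH) is the solution on $[0,T_{\max}(\varphi))$. Definition. Let $s\ge 0$. The problem (NLH)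 is locally well posed for small data in $H^s(\mathbb R^N)$ if there exist $\delta,T>0$ such that, whenever $\varphi\in C_c^\infty(\mathbb R^N)$ and $\|\varphi\|_{H^s}\le\delta$, one has $T_{\max}(\varphi)\ge T$ and the corresponding solution $u\in C([0,T_{\max}(\varphi)),C_0(\mathbb R^N))$ satisfies $u(t)\in H^s(\mathbb R^N)$ for all $0\le t\le T$ with $t<T_{\max}(\varphi)$. Theorem. Let $0<\alpha<2$, let $\lambda>0$ be real, and let $N$ be a positive integer with $$N>11+\frac4\alpha .$$ Then for every $s\ge 0$ the Cauchy problem (NLH) is not locally well posed for small data in $H^s(\mathbb R^N)$. -/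

import Mathlib

open MeasureTheory Set TemperedDistribution
open scoped ENNReal ZeroAtInfty SchwartzMap ContDiff

noncomputable section

namespace NLHeat

/-- The space `ℝ^N` with its Euclidean norm. -/
abbrev Space (N : ℕ) : Type := EuclideanSpace ℝ (Fin N)

/-- The Gaussian heat kernel `(4πt)^(-N/2) exp(-|x|²/(4t))`, used for `t > 0`. -/
def heatKernel {N : ℕ} (t : ℝ) (x : Space N) : ℝ :=
  (4 * Real.pi * t) ^ (-(N : ℝ) / 2) * Real.exp (-‖x‖ ^ 2 / (4 * t))

/-- The heat semigroup `e^{tΔ}`, `t ≥ 0`: convolution with the heat kernel for `t > 0`, and the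
identity for `t = 0`. -/
def heatSemigroup {N : ℕ} (t : ℝ) (f : Space N → ℂ) (x : Space N) : ℂ :=
  if 0 < t then ∫ y, (heatKernel t (x - y) : ℂ) * f y else f x

/-- `u ∈ C([0, T), C₀(ℝ^N))` (with `0 ≤ T ≤ ∞`) is a solution on `[0, T)` of
`u_t = Δu + lam |u|^α u`, `u(0) = φ`, in the standard sense of Duhamel's formula
`u(t) = e^{tΔ} φ + lam ∫₀ᵗ e^{(t-σ)Δ} (|u(σ)|^α u(σ)) dσ` for `0 ≤ t < T`. -/
structure IsSolutionOn {N : ℕ} (α : ℝ) (lam : ℂ) (φ : C₀(Space N, ℂ)) (T : ℝ≥0∞)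
    (u : ℝ → C₀(Space N, ℂ)) : Prop where
  continuousOn : ContinuousOn u {t : ℝ | 0 ≤ t ∧ ENNReal.ofReal t < T}
  duhamel : ∀ t : ℝ, 0 ≤ t → ENNReal.ofReal t < T → ∀ x : Space N,
    u t x = heatSemigroup t φ x + lam * ∫ σ in (0 : ℝ)..t,
      heatSemigroup (t - σ) (fun y ↦ ((‖u σ y‖ ^ α : ℝ) : ℂ) * u σ y) x

/-- The maximal existence time in `C₀(ℝ^N)`: the supremum of the `T ∈ [0, ∞]` such that there is
a solution on `[0, T)`. -/
def maximalTime {N : ℕ} (α : ℝ) (lam : ℂ) (φ : C₀(Space N, ℂ)) : ℝ≥0∞ :=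
  sSup {T : ℝ≥0∞ | ∃ u : ℝ → C₀(Space N, ℂ), IsSolutionOn α lam φ T u}

/-- A function in `C₀(ℝ^N)` regarded as a tempered distribution `g ↦ ∫ g f`. -/
def toDistribution {N : ℕ} (f : C₀(Space N, ℂ)) : 𝓢'(Space N, ℂ) :=
  ((f.toBCF.memLp_top (μ := volume)).toLp f.toBCF : Lp ℂ ∞ (volume : Measure (Space N)))

/-- `f ∈ H^s(ℝ^N)`, i.e. `𝓕⁻¹ (1 + |ξ|²)^(s/2) 𝓕 f ∈ L²`. -/
def MemHs {N : ℕ} (s : ℝ) (f : C₀(Space N, ℂ)) : Prop :=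
  MemSobolev s 2 (toDistribution f)

/-- The norm `‖f‖_{H^s} = ‖𝓕⁻¹ (1 + |ξ|²)^(s/2) 𝓕 f‖_{L²}`, with value `∞` if `f ∉ H^s(ℝ^N)`.
(The infimum is over the at most one function `g ∈ L²` that represents the distribution
`𝓕⁻¹ (1 + |ξ|²)^(s/2) 𝓕 f`.) -/
def hsNorm {N : ℕ} (s : ℝ) (f : C₀(Space N, ℂ)) : ℝ≥0∞ :=
  ⨅ (g : Lp ℂ 2 (volume : Measure (Space N)))
    (_ : besselPotential (Space N) ℂ s (toDistribution f) = (g : 𝓢'(Space N, ℂ))), ‖g‖ₑ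

/-- Local well-posedness for small data in `H^s(ℝ^N)`: there are `δ, T > 0` such that for every
`φ ∈ C_c^∞(ℝ^N)` with `‖φ‖_{H^s} ≤ δ` the maximal existence time is at least `T` and the
corresponding maximal solution in `C([0, Tmax), C₀(ℝ^N))` satisfies `u(t) ∈ H^s(ℝ^N)` for all
`0 ≤ t ≤ T`. (At `t = T` this is only required when `T < Tmax`, so that `u(T)` makes sense;
dividing `T` by two shows that this makes no difference.) -/
def LocallyWellPosedSmallData (N : ℕ) (s α : ℝ) (lam : ℂ) : Prop :=
  ∃ δ T : ℝ, 0 < δ ∧ 0 < T ∧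
    ∀ φ : C₀(Space N, ℂ), ContDiff ℝ ∞ (φ : Space N → ℂ) →
      HasCompactSupport (φ : Space N → ℂ) → hsNorm s φ ≤ ENNReal.ofReal δ →
        ENNReal.ofReal T ≤ maximalTime α lam φ ∧
        ∀ u : ℝ → C₀(Space N, ℂ), IsSolutionOn α lam φ (maximalTime α lam φ) u →
          ∀ t : ℝ, 0 ≤ t → t ≤ T → ENNReal.ofReal t < maximalTime α lam φ → MemHs s (u t)

end NLHeat

end

/-! Two different mechanisms break well-posedness, and `N > 11 + 4/α` makes their ranges of `s`
cover `[0, ∞)`.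

For `s < N/2 - 2/α` the space is scaling supercritical. Data `A μ^(2/α) B(μ x)` with a fixed bump `B
≥ 0` become small in `H^s` as `μ → ∞`. A nonnegative solution on `[0, T]` must satisfy `α lam T
(e^{TΔ}φ(0))^α ≤ 1`: by Jensen, `J(t) = e^{(T-t)Δ}u(t)(0)` obeys `J' ≥ lam J^(1+α)`. At time `μ⁻²`
this bound does not depend on `μ` and fails for `A` large, so the existence times shrink to zero.
See `IsMild.mul_rpow_heatSemigroup_le_one` and `not_locallyWellPosed_of_lt`.

For `s ≥ 11/2` the obstruction is the limited smoothness of `|z|^α z` at `z = 0`. Take small data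
equal to `κ xᵢ` near the origin and odd in `xᵢ`. The solution stays odd, hence vanishes on `xᵢ = 0`,
and `|u(t) - φ| ≤ K t |xᵢ|` (`IsMild.norm_sub_le_of_odd`). For short times the nonlinearity is
therefore `κ^(1+α) |xᵢ|^α xᵢ` near the origin, up to a small relative error. That function lies
locally in `H^σ` only for `σ < α + 3/2 < 7/2`, whereas the equation would place the time integral of
the nonlinearity in `H^(s-2)` with `s - 2 ≥ 7/2`.

The contradiction is made quantitative by duality. Baire's theorem turns membership in `H^s` at each
time into a uniform bound on some `[a, b]`. The distributional equation is tested with fourth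
differences, of step `ε`, of a bump of width `ε` in `xᵢ` (`exists_testFunctions`). The terms with
`u` are `O(ε^4)`, while the nonlinear term is at least a constant times `ε^(2+α)`. Since `α < 2`,
letting `ε → 0` is absurd. -/

namespace NLHeat

variable {N : ℕ}

/-! ### Heat kernel and heat semigroup -/

theorem heatKernel_pos {t : ℝ} (ht : 0 < t) (x : Space N) : 0 < heatKernel t x := by
  unfold heatKernel
  have := Real.pi_pos
  positivity

@[fun_prop]
theorem continuous_heatKernel (t : ℝ) : Continuous (heatKernel t : Space N → ℝ) := by
  unfold heatKernel
  fun_prop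

theorem heatKernel_eq (t : ℝ) (x : Space N) :
    heatKernel t x = (4 * Real.pi * t) ^ (-(N : ℝ) / 2) * Real.exp (-(4 * t)⁻¹ * ‖x‖ ^ 2) := by
  unfold heatKernel
  congr 2
  rw [neg_div, div_eq_inv_mul, neg_mul]

theorem integral_heatKernel {t : ℝ} (ht : 0 < t) : ∫ x : Space N, heatKernel t x = 1 := by
  have hpi := Real.pi_pos
  simp_rw [heatKernel_eq]
  rw [integral_const_mul, GaussianFourier.integral_rexp_neg_mul_sq_norm (by positivity)]
  rw [finrank_euclideanSpace_fin, div_inv_eq_mul, show Real.pi * (4 * t) = 4 * Real.pi * t by ring,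
    ← Real.rpow_add (by positivity)]
  ring_nf
  simp

theorem integrable_heatKernel {t : ℝ} (ht : 0 < t) :
    Integrable (heatKernel t : Space N → ℝ) := by
  -- The integral of a nonintegrable function is `0` by convention, but this one is `1`.
  by_contra h
  have := integral_undef h
  rw [integral_heatKernel ht] at this
  exact one_ne_zero this

theorem heatKernel_neg (t : ℝ) (x : Space N) : heatKernel t (-x) = heatKernel t x := by
  simp [heatKernel]

theorem heatKernel_sqrt_smul {t : ℝ} (ht : 0 < t) (z : Space N) :
    heatKernel t (√t • z) = t ^ (-(N : ℝ) / 2) * heatKernel 1 z := by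
  have hpi := Real.pi_pos
  unfold heatKernel
  rw [Real.mul_rpow (by positivity) ht.le, norm_smul, Real.norm_of_nonneg (Real.sqrt_nonneg _),
    mul_pow, Real.sq_sqrt ht.le]
  simp only [mul_one]
  have : -(t * ‖z‖ ^ 2) / (4 * t) = -‖z‖ ^ 2 / 4 := by field_simp
  rw [this]
  ring

/-- The heat semigroup as an average against the standard heat kernel. -/
theorem heatSemigroup_eq (t : ℝ) (f : Space N → ℂ) (x : Space N) :
    heatSemigroup t f x = ∫ z, (heatKernel 1 z : ℂ) * f (x - √t • z) := by
  unfold heatSemigroup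
  split_ifs with ht
  · have h1 : ∫ y, (heatKernel t (x - y) : ℂ) * f y
        = ∫ y, (heatKernel t y : ℂ) * f (x - y) := by
      rw [← integral_sub_left_eq_self _ volume x]
      simp
    rw [h1]
    have h2 := Measure.integral_comp_smul (volume : Measure (Space N))
      (fun y ↦ (heatKernel t y : ℂ) * f (x - y)) (√t)
    have hs : 0 < √t := Real.sqrt_pos.2 ht
    rw [finrank_euclideanSpace_fin, abs_of_pos (by positivity)] at h2
    have h3 : ∫ y, (heatKernel t y : ℂ) * f (x - y)
        = (√t ^ N) • ∫ z, (heatKernel t (√t • z) : ℂ) * f (x - √t • z) := by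
      rw [h2, smul_smul, mul_inv_cancel₀ (by positivity), one_smul]
    rw [h3, ← integral_smul]
    congr 1
    ext z
    rw [heatKernel_sqrt_smul ht, Complex.real_smul]
    have h4 : √t ^ N * t ^ (-(N : ℝ) / 2) = 1 := by
      rw [Real.sqrt_eq_rpow, ← Real.rpow_natCast, ← Real.rpow_mul ht.le, ← Real.rpow_add ht]
      ring_nf
      simp
    rw [← mul_assoc, ← Complex.ofReal_mul, ← mul_assoc, h4, one_mul]
  -- For `t ≤ 0` the default value `√t = 0` turns the average into `f x`, matching the convention in
  -- `heatSemigroup`.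
  · rw [Real.sqrt_eq_zero_of_nonpos (not_lt.1 ht)]
    simp only [zero_smul, sub_zero]
    rw [integral_mul_const, integral_complex_ofReal, integral_heatKernel one_pos]
    simp

theorem norm_heatSemigroup_le (t : ℝ) {f : Space N → ℂ} {M : ℝ} (hf : ∀ y, ‖f y‖ ≤ M)
    (x : Space N) : ‖heatSemigroup t f x‖ ≤ M := by
  rw [heatSemigroup_eq]
  have h := norm_integral_le_of_norm_le (μ := (volume : Measure (Space N)))
    (f := fun z ↦ (heatKernel 1 z : ℂ) * f (x - √t • z))
    ((integrable_heatKernel (N := N) one_pos).mul_const M) (.of_forall fun z ↦ by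
      rw [norm_mul, Complex.norm_real, Real.norm_of_nonneg (heatKernel_pos one_pos z).le]
      exact mul_le_mul_of_nonneg_left (hf _) (heatKernel_pos one_pos z).le)
  rwa [integral_mul_const, integral_heatKernel one_pos, one_mul] at h

theorem integrable_heatKernel_mul {t : ℝ} (ht : 0 < t) {g : Space N → ℂ}
    (hg : Continuous g) {M : ℝ} (hM : ∀ y, ‖g y‖ ≤ M) :
    Integrable fun z : Space N ↦ (heatKernel t z : ℂ) * g z := by
  refine ((integrable_heatKernel (N := N) ht).ofReal (𝕜 := ℂ)).mul_bdd (c := M)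
    hg.aestronglyMeasurable (.of_forall hM)

theorem heatSemigroup_sub (t : ℝ) {f g : Space N → ℂ} (hf : Continuous f) (hg : Continuous g)
    {M M' : ℝ} (hM : ∀ y, ‖f y‖ ≤ M) (hM' : ∀ y, ‖g y‖ ≤ M') (x : Space N) :
    heatSemigroup t (fun y ↦ f y - g y) x = heatSemigroup t f x - heatSemigroup t g x := by
  simp only [heatSemigroup_eq]
  rw [← integral_sub]
  · simp only [mul_sub]
  · exact integrable_heatKernel_mul one_pos (by fun_prop) fun y ↦ hM _
  · exact integrable_heatKernel_mul one_pos (by fun_prop) fun y ↦ hM' _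

/-- After rescaling, the kernel no longer depends on time, so dominated convergence gives joint
continuity, including at `t = 0`. -/
theorem continuous_heatSemigroup {X : Type*} [TopologicalSpace X] [FirstCountableTopology X]
    {F : X → Space N → ℂ} (hF : Continuous fun p : X × Space N ↦ F p.1 p.2)
    {M : ℝ} (hM : ∀ p y, ‖F p y‖ ≤ M) {τ : X → ℝ} (hτ : Continuous τ)
    {y : X → Space N} (hy : Continuous y) :
    Continuous fun p ↦ heatSemigroup (τ p) (F p) (y p) := by
  simp only [heatSemigroup_eq]
  refine continuous_of_dominated (bound := fun z ↦ heatKernel 1 z * M) ?_ ?_ ?_ ?_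
  · intro p
    have : Continuous fun z ↦ F p (y p - √(τ p) • z) :=
      hF.comp (Continuous.prodMk continuous_const (by fun_prop))
    exact Continuous.aestronglyMeasurable (by fun_prop)
  · intro p
    refine .of_forall fun z ↦ ?_
    rw [norm_mul, Complex.norm_real, Real.norm_of_nonneg (heatKernel_pos one_pos z).le]
    exact mul_le_mul_of_nonneg_left (hM _ _) (heatKernel_pos one_pos z).le
  · exact (integrable_heatKernel one_pos).mul_const M
  · refine .of_forall fun z ↦ ?_
    have : Continuous fun p ↦ F p (y p - √(τ p) • z) :=
      hF.comp (Continuous.prodMk continuous_id (by fun_prop))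
    fun_prop

theorem heatSemigroup_comp_isometry (t : ℝ) (f : Space N → ℂ) (L : Space N ≃ₗᵢ[ℝ] Space N)
    (x : Space N) : heatSemigroup t (fun y ↦ f (L y)) x = heatSemigroup t f (L x) := by
  simp only [heatSemigroup_eq]
  rw [← L.measurePreserving.integral_comp L.toHomeomorph.measurableEmbedding
    (fun z ↦ (heatKernel 1 z : ℂ) * f (L x - √t • z))]
  simp [heatKernel]

theorem heatSemigroup_comp_add (t : ℝ) (f : Space N → ℂ) (k : Space N) (x : Space N) :
    heatSemigroup t (fun y ↦ f (y + k)) x = heatSemigroup t f (x + k) := by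
  simp only [heatSemigroup_eq, sub_add_eq_add_sub]

theorem heatSemigroup_neg (t : ℝ) (f : Space N → ℂ) (x : Space N) :
    heatSemigroup t (fun y ↦ -f y) x = -heatSemigroup t f x := by
  simp only [heatSemigroup_eq, mul_neg, integral_neg]

/-! ### The power nonlinearity and a Gronwall inequality -/

/-- The nonlinearity `|z|^α z`. -/
noncomputable def powNl (α : ℝ) (z : ℂ) : ℂ := ((‖z‖ ^ α : ℝ) : ℂ) * z

theorem norm_powNl_le {α : ℝ} (hα : 0 < α) {M : ℝ} {z : ℂ} (hz : ‖z‖ ≤ M) :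
    ‖powNl α z‖ ≤ M ^ α * M := by
  unfold powNl
  have : 0 ≤ M := (norm_nonneg z).trans hz
  rw [norm_mul, Complex.norm_real, Real.norm_of_nonneg (by positivity)]
  gcongr

theorem continuous_powNl {α : ℝ} (hα : 0 < α) : Continuous (powNl α) := by
  unfold powNl
  have : Continuous fun z : ℂ ↦ ‖z‖ ^ α :=
    continuous_norm.rpow_const fun _ ↦ Or.inr hα.le
  fun_prop

theorem powNl_neg (α : ℝ) (z : ℂ) : powNl α (-z) = -powNl α z := by
  simp [powNl]

/-- Since `b / a ≤ 1` and `α < 2`, the power `(b / a) ^ α` can be replaced by the square, for which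
the difference factors explicitly. -/
theorem rpow_sub_rpow_mul_le {α : ℝ} (hα2 : α < 2) {a b : ℝ} (hb : 0 ≤ b)
    (hab : b ≤ a) : (a ^ α - b ^ α) * b ≤ 2 * a ^ α * (a - b) := by
  rcases hb.eq_or_lt with rfl | hb
  · have : 0 ≤ a ^ α := by positivity
    simp only [mul_zero]
    positivity
  have ha : 0 < a := hb.trans_le hab
  have h1 : b ^ α = a ^ α * (b / a) ^ α := by
    rw [← Real.mul_rpow ha.le (by positivity)]
    field_simp
  have h2 : (b / a) ^ (2 : ℝ) ≤ (b / a) ^ α :=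
    Real.rpow_le_rpow_of_exponent_ge (by positivity) (by rw [div_le_one ha]; exact hab) hα2.le
  rw [Real.rpow_two] at h2
  have h3 : (1 - (b / a) ^ α) * b ≤ 2 * (a - b) := by
    calc (1 - (b / a) ^ α) * b ≤ (1 - (b / a) ^ 2) * b := by gcongr
      _ = (b / a + (b / a) ^ 2) * (a - b) := by field_simp; ring
      _ ≤ 2 * (a - b) := by
        have : b / a ≤ 1 := by rw [div_le_one ha]; exact hab
        have h0 : 0 ≤ b / a := by positivity
        refine mul_le_mul_of_nonneg_right ?_ (by linarith)
        nlinarith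
  calc (a ^ α - b ^ α) * b = a ^ α * ((1 - (b / a) ^ α) * b) := by rw [h1]; ring
    _ ≤ a ^ α * (2 * (a - b)) := by gcongr
    _ = _ := by ring

/-- With `|w| ≤ |z|`, split off `|z|^α (z - w)`, which costs `1`. The remaining `(|z|^α - |w|^α) w`
costs `2` by `rpow_sub_rpow_mul_le`. -/
theorem norm_powNl_sub_le {α : ℝ} (hα : 0 < α) (hα2 : α < 2) {M : ℝ} {z w : ℂ}
    (hz : ‖z‖ ≤ M) (hw : ‖w‖ ≤ M) :
    ‖powNl α z - powNl α w‖ ≤ 3 * M ^ α * ‖z - w‖ := by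
  wlog h : ‖w‖ ≤ ‖z‖ generalizing z w
  · rw [norm_sub_rev, norm_sub_rev z w]
    exact this hw hz (le_of_not_ge h)
  have h1 : powNl α z - powNl α w
      = ((‖z‖ ^ α : ℝ) : ℂ) * (z - w) + ((‖z‖ ^ α - ‖w‖ ^ α : ℝ) : ℂ) * w := by
    unfold powNl; push_cast; ring
  have h2 : ‖w‖ ^ α ≤ ‖z‖ ^ α := by gcongr
  have h3 : ‖z‖ ^ α ≤ M ^ α := by gcongr
  rw [h1]
  refine (norm_add_le _ _).trans ?_
  rw [norm_mul, norm_mul, Complex.norm_real, Complex.norm_real,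
    Real.norm_of_nonneg (by positivity), Real.norm_of_nonneg (by linarith)]
  calc ‖z‖ ^ α * ‖z - w‖ + (‖z‖ ^ α - ‖w‖ ^ α) * ‖w‖
      ≤ ‖z‖ ^ α * ‖z - w‖ + 2 * ‖z‖ ^ α * (‖z‖ - ‖w‖) := by
        exact add_le_add le_rfl (rpow_sub_rpow_mul_le hα2 (norm_nonneg _) h)
    _ ≤ ‖z‖ ^ α * ‖z - w‖ + 2 * ‖z‖ ^ α * ‖z - w‖ := by
        gcongr; exact norm_sub_norm_le _ _
    _ = 3 * ‖z‖ ^ α * ‖z - w‖ := by ring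
    _ ≤ _ := by gcongr

/-- A Gronwall inequality for families of functions without measurability assumptions. -/
theorem le_of_integral_bootstrap {X : Type*} {d : ℝ → X → ℝ} {T C A D : ℝ} (hC : 0 < C)
    (hA : 0 ≤ A) (hD : 0 ≤ D) (hdA : ∀ t ∈ Icc 0 T, ∀ x, d t x ≤ A)
    (H : ∀ B, 0 ≤ B → (∀ σ ∈ Icc 0 T, ∀ x, d σ x ≤ B * Real.exp (2 * C * σ)) →
      ∀ t ∈ Icc 0 T, ∀ x, d t x ≤ D + C * ∫ σ in (0 : ℝ)..t, B * Real.exp (2 * C * σ)) :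
    ∀ t ∈ Icc 0 T, ∀ x, d t x ≤ 2 * D * Real.exp (2 * C * t) := by
  have hI : ∀ B t : ℝ, C * ∫ σ in (0 : ℝ)..t, B * Real.exp (2 * C * σ)
      = B / 2 * (Real.exp (2 * C * t) - 1) := by
    intro B t
    rw [intervalIntegral.integral_const_mul,
      intervalIntegral.integral_comp_mul_left _ (by positivity)]
    simp
    field_simp
  -- The weight has rate `2C`, so each application of `H` halves the excess of the bound over `2D`;
  -- only the a priori bound `A` is needed to start.
  have step : ∀ n : ℕ, ∀ t ∈ Icc 0 T, ∀ x,
      d t x ≤ (2 * D + A / 2 ^ n) * Real.exp (2 * C * t) := by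
    intro n
    induction n with
    | zero =>
      intro t ht x
      have h1 : 1 ≤ Real.exp (2 * C * t) := Real.one_le_exp (by have := ht.1; positivity)
      have := hdA t ht x
      simp only [pow_zero, div_one]
      nlinarith
    | succ n ih =>
      intro t ht x
      have h := H _ (by positivity) ih t ht x
      rw [hI] at h
      have h1 : 1 ≤ Real.exp (2 * C * t) := Real.one_le_exp (by have := ht.1; positivity)
      have h2 : 0 ≤ A / 2 ^ n := by positivity
      have h3 : A / 2 ^ (n + 1) = A / 2 ^ n / 2 := by rw [pow_succ]; field_simp
      rw [h3]
      nlinarith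
  intro t ht x
  have hlim : Filter.Tendsto (fun n : ℕ ↦ (2 * D + A / 2 ^ n) * Real.exp (2 * C * t)) Filter.atTop
      (nhds ((2 * D + 0) * Real.exp (2 * C * t))) := by
    refine Filter.Tendsto.mul_const _ (Filter.Tendsto.const_add _ ?_)
    exact tendsto_const_nhds.div_atTop (tendsto_pow_atTop_atTop_of_one_lt one_lt_two)
  rw [add_zero] at hlim
  exact ge_of_tendsto' hlim fun n ↦ step n t ht x

end NLHeat

/-! ### Mild solutions: symmetries and continuous dependence -/

namespace NLHeat

variable {N : ℕ}

/-- A bounded continuous function on space-time which satisfies Duhamel's formula on `[0, T]`. -/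
structure IsMild (α : ℝ) (lam : ℂ) (φ : Space N → ℂ) (T M : ℝ) (u : ℝ → Space N → ℂ) : Prop where
  cont : Continuous fun p : ℝ × Space N ↦ u p.1 p.2
  bound : ∀ t x, ‖u t x‖ ≤ M
  duhamel : ∀ t ∈ Icc 0 T, ∀ x, u t x = heatSemigroup t φ x
    + lam * ∫ σ in (0 : ℝ)..t, heatSemigroup (t - σ) (fun y ↦ powNl α (u σ y)) x

namespace IsMild

variable {α T M : ℝ} {lam : ℂ} {φ ψ : Space N → ℂ} {u v : ℝ → Space N → ℂ}

theorem nonneg (hu : IsMild α lam φ T M u) : 0 ≤ M :=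
  (norm_nonneg _).trans (hu.bound 0 0)

theorem cont_space (hu : IsMild α lam φ T M u) (t : ℝ) : Continuous (u t) :=
  hu.cont.comp (Continuous.prodMk continuous_const continuous_id)

theorem cont_powNl (hα : 0 < α) (hu : IsMild α lam φ T M u) :
    Continuous fun p : ℝ × Space N ↦ powNl α (u p.1 p.2) :=
  (continuous_powNl hα).comp hu.cont

theorem cont_powNl_space (hα : 0 < α) (hu : IsMild α lam φ T M u) (t : ℝ) :
    Continuous fun y ↦ powNl α (u t y) := (continuous_powNl hα).comp (hu.cont_space t)

theorem bound_powNl (hα : 0 < α) (hu : IsMild α lam φ T M u) (t : ℝ) (x : Space N) :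
    ‖powNl α (u t x)‖ ≤ M ^ α * M := norm_powNl_le hα (hu.bound t x)

theorem cont_integrand (hα : 0 < α) (hu : IsMild α lam φ T M u) :
    Continuous fun p : ℝ × ℝ × Space N ↦
      heatSemigroup p.1 (fun y ↦ powNl α (u p.2.1 y)) p.2.2 := by
  refine continuous_heatSemigroup (X := ℝ × ℝ × Space N)
    (F := fun p y ↦ powNl α (u p.2.1 y)) (M := M ^ α * M) ?_ ?_ (by fun_prop) (by fun_prop)
  · exact (hu.cont_powNl hα).comp (g := fun p : ℝ × Space N ↦ powNl α (u p.1 p.2))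
      (f := fun p : (ℝ × ℝ × Space N) × Space N ↦ (p.1.2.1, p.2)) (by fun_prop)
  · intro p y
    exact hu.bound_powNl hα _ _

theorem cont_integrand_sub (hα : 0 < α) (hu : IsMild α lam φ T M u) (t : ℝ) (x : Space N) :
    Continuous fun σ ↦ heatSemigroup (t - σ) (fun y ↦ powNl α (u σ y)) x :=
  (hu.cont_integrand hα).comp (g := fun p : ℝ × ℝ × Space N ↦
      heatSemigroup p.1 (fun y ↦ powNl α (u p.2.1 y)) p.2.2)
    (f := fun σ ↦ (t - σ, σ, x)) (by fun_prop)

theorem mono (hu : IsMild α lam φ T M u) {T' M' : ℝ} (hT : T' ≤ T) (hM : M ≤ M') :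
    IsMild α lam φ T' M' u :=
  ⟨hu.cont, fun t x ↦ (hu.bound t x).trans hM, fun t ht ↦ hu.duhamel t ⟨ht.1, ht.2.trans hT⟩⟩

/-- Comparing a solution with its translates through `norm_sub_le` yields Lipschitz bounds in space.
-/
theorem comp_add (hu : IsMild α lam φ T M u) (k : Space N) :
    IsMild α lam (fun x ↦ φ (x + k)) T M (fun t x ↦ u t (x + k)) where
  cont := hu.cont.comp (g := fun p : ℝ × Space N ↦ u p.1 p.2)
    (f := fun p : ℝ × Space N ↦ (p.1, p.2 + k)) (by fun_prop)
  bound t x := hu.bound _ _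
  duhamel t ht x := by
    rw [hu.duhamel t ht, heatSemigroup_comp_add]
    congr 3
    ext σ
    rw [← heatSemigroup_comp_add]

/-- Together with `neg` and uniqueness, this shows that data odd under a reflection have odd
solutions. -/
theorem comp_isometry (hu : IsMild α lam φ T M u) (L : Space N ≃ₗᵢ[ℝ] Space N) :
    IsMild α lam (fun x ↦ φ (L x)) T M (fun t x ↦ u t (L x)) where
  cont := hu.cont.comp (g := fun p : ℝ × Space N ↦ u p.1 p.2)
    (f := fun p : ℝ × Space N ↦ (p.1, L p.2)) (by fun_prop)
  bound t x := hu.bound _ _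
  duhamel t ht x := by
    rw [hu.duhamel t ht, heatSemigroup_comp_isometry]
    congr 3
    ext σ
    rw [← heatSemigroup_comp_isometry]

theorem neg (hu : IsMild α lam φ T M u) :
    IsMild α lam (fun x ↦ -φ x) T M (fun t x ↦ -u t x) where
  cont := hu.cont.neg
  bound t x := by rw [norm_neg]; exact hu.bound _ _
  duhamel t ht x := by
    rw [hu.duhamel t ht, heatSemigroup_neg, neg_add, ← mul_neg, ← intervalIntegral.integral_neg]
    congr 3
    ext σ
    simp only [powNl_neg, heatSemigroup_neg]

/-- The difference of the Duhamel terms of two mild solutions. -/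
theorem norm_duhamel_sub_le (hα : 0 < α) (hα2 : α < 2) (hu : IsMild α lam φ T M u)
    (hv : IsMild α lam ψ T M v) {t : ℝ} (ht : 0 ≤ t) (x : Space N) {g : ℝ → ℝ}
    (hg : Continuous g) (h : ∀ σ ∈ Icc 0 t, ∀ y, ‖u σ y - v σ y‖ ≤ g σ) :
    ‖lam * (∫ σ in (0 : ℝ)..t, heatSemigroup (t - σ) (fun y ↦ powNl α (u σ y)) x)
      - lam * ∫ σ in (0 : ℝ)..t, heatSemigroup (t - σ) (fun y ↦ powNl α (v σ y)) x‖
      ≤ ‖lam‖ * (3 * M ^ α) * ∫ σ in (0 : ℝ)..t, g σ := by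
  rw [← mul_sub, ← intervalIntegral.integral_sub
    ((hu.cont_integrand_sub hα t x).intervalIntegrable _ _)
    ((hv.cont_integrand_sub hα t x).intervalIntegrable _ _), norm_mul, mul_assoc]
  refine mul_le_mul_of_nonneg_left ?_ (norm_nonneg _)
  rw [← intervalIntegral.integral_const_mul]
  refine intervalIntegral.norm_integral_le_of_norm_le ht ?_
    ((hg.const_mul _).intervalIntegrable _ _)
  refine .of_forall fun σ hσ ↦ ?_
  rw [← heatSemigroup_sub (M := M ^ α * M) (M' := M ^ α * M)]
  · refine norm_heatSemigroup_le _ (fun y ↦ ?_) x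
    refine (norm_powNl_sub_le hα hα2 (hu.bound _ _) (hv.bound _ _)).trans ?_
    have := hu.nonneg
    exact mul_le_mul_of_nonneg_left (h σ ⟨hσ.1.le, hσ.2⟩ y) (by positivity)
  · exact hu.cont_powNl_space hα σ
  · exact hv.cont_powNl_space hα σ
  · exact hu.bound_powNl hα σ
  · exact hv.bound_powNl hα σ

/-- Continuous dependence on the data in the sup norm. -/
theorem norm_sub_le (hα : 0 < α) (hα2 : α < 2) (hu : IsMild α lam φ T M u)
    (hv : IsMild α lam ψ T M v) (hφ : Continuous φ) (hψ : Continuous ψ) {A : ℝ}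
    (hφA : ∀ x, ‖φ x‖ ≤ A) (hψA : ∀ x, ‖ψ x‖ ≤ A) {D : ℝ} (hD : ∀ x, ‖φ x - ψ x‖ ≤ D) :
    ∀ t ∈ Icc 0 T, ∀ x,
      ‖u t x - v t x‖ ≤ 2 * D * Real.exp (2 * (‖lam‖ * (3 * M ^ α) + 1) * t) := by
  have hM := hu.nonneg
  have hD0 : 0 ≤ D := (norm_nonneg _).trans (hD 0)
  -- The `+ 1` in the rate keeps it positive when `lam` or `M` vanishes.
  refine le_of_integral_bootstrap (d := fun t x ↦ ‖u t x - v t x‖) (by positivity)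
    (A := M + M) (by positivity) hD0 ?_ ?_
  · intro t _ x
    exact (_root_.norm_sub_le _ _).trans (add_le_add (hu.bound _ _) (hv.bound _ _))
  · intro B hB h t ht x
    have h1 := norm_duhamel_sub_le hα hα2 hu hv ht.1 x
      (g := fun σ ↦ B * Real.exp (2 * (‖lam‖ * (3 * M ^ α) + 1) * σ)) (by fun_prop)
      (fun σ hσ y ↦ h σ ⟨hσ.1, hσ.2.trans ht.2⟩ y)
    have h2 : ‖heatSemigroup t φ x - heatSemigroup t ψ x‖ ≤ D := by
      rw [← heatSemigroup_sub t hφ hψ hφA hψA]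
      exact norm_heatSemigroup_le _ hD _
    have h3 : 0 ≤ ∫ σ in (0 : ℝ)..t, B * Real.exp (2 * (‖lam‖ * (3 * M ^ α) + 1) * σ) :=
      intervalIntegral.integral_nonneg ht.1 fun σ _ ↦ by positivity
    rw [hu.duhamel t ht, hv.duhamel t ht, add_sub_add_comm]
    refine (norm_add_le _ _).trans ?_
    refine (add_le_add h2 h1).trans ?_
    gcongr
    linarith

end IsMild

end NLHeat

/-! ### Fourier representation of the heat semigroup -/

namespace NLHeat

variable {N : ℕ}

open FourierTransform Laplacian

theorem fourier_gaussianPhase {t : ℝ} (ht : 0 < t) (x y : Space N) :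
    𝓕 (fun v : Space N ↦ Complex.exp (-((4 * Real.pi ^ 2 * t : ℝ) : ℂ) * ‖v‖ ^ 2
      + 2 * Real.pi * Complex.I * inner ℝ x v)) y = heatKernel t (x - y) := by
  have hpi := Real.pi_pos
  rw [fourier_gaussian_innerProductSpace' (by rw [Complex.ofReal_re]; positivity),
    finrank_euclideanSpace_fin, heatKernel]
  push_cast
  congr 1
  · rw [Complex.ofReal_cpow (by positivity)]
    push_cast
    have h1 : (Real.pi : ℂ) / (4 * Real.pi ^ 2 * t) = ((4 * Real.pi * t)⁻¹ : ℝ) := by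
      push_cast
      field_simp
    rw [h1, show ((4 * Real.pi * t : ℂ)) = ((4 * Real.pi * t : ℝ) : ℂ) by push_cast; rfl,
      Complex.ofReal_inv, neg_div, Complex.cpow_neg, Complex.inv_cpow]
    rw [Complex.arg_ofReal_of_nonneg (by positivity)]
    exact hpi.ne
  · congr 1
    field_simp

/-- The Fourier transform is moved from the Gaussian with phase to `h` by `∫ 𝓕h · g = ∫ h · 𝓕g`; the
phase carries the translation by `x`. -/
theorem heatSemigroup_eq_fourier {t : ℝ} (ht : 0 < t) {h : Space N → ℂ} (hh : Integrable h)
    (x : Space N) : heatSemigroup t h x = ∫ ξ, 𝓕 h ξ *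
      Complex.exp (-((4 * Real.pi ^ 2 * t : ℝ) : ℂ) * ‖ξ‖ ^ 2
      + 2 * Real.pi * Complex.I * inner ℝ x ξ) := by
  have hpi := Real.pi_pos
  have key := VectorFourier.integral_fourierIntegral_smul_eq_flip (μ := volume) (ν := volume)
    (f := h) (g := fun v : Space N ↦ Complex.exp (-((4 * Real.pi ^ 2 * t : ℝ) : ℂ) * ‖v‖ ^ 2
      + 2 * Real.pi * Complex.I * inner ℝ x v)) (L := innerₗ (Space N))
    Real.continuous_fourierChar continuous_inner hh
    (GaussianFourier.integrable_cexp_neg_mul_sq_norm_add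
      (by rw [Complex.ofReal_re]; positivity) _ _)
  rw [flip_innerₗ] at key
  simp only [smul_eq_mul] at key
  refine Eq.trans ?_ key.symm
  rw [heatSemigroup, if_pos ht]
  congr 1
  ext y
  rw [← fourier_gaussianPhase ht, mul_comm]
  rfl

theorem fourier_laplacian (h : 𝓢(Space N, ℂ)) (ξ : Space N) :
    𝓕 (Δ h : 𝓢(Space N, ℂ)) ξ = -((2 * Real.pi) ^ 2 * ‖ξ‖ ^ 2 : ℝ) * 𝓕 h ξ := by
  rw [SchwartzMap.laplacian_eq_fourierMultiplierCLM, SchwartzMap.fourierMultiplierCLM_apply,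
    FourierTransform.fourier_smul, FourierTransform.fourier_fourierInv_eq, _root_.smul_apply,
    SchwartzMap.smulLeftCLM_apply_apply (by fun_prop)]
  simp
  ring

end NLHeat

/-! ### Fubini arguments, symmetry and the semigroup law -/

namespace NLHeat

variable {N : ℕ}

open FourierTransform Laplacian

theorem integral_intervalIntegral_mul_swap {X : Type*} [TopologicalSpace X] [MeasurableSpace X]
    [OpensMeasurableSpace X] [SecondCountableTopology X] {μ : Measure X} [SFinite μ]
    {G : ℝ → X → ℂ} (hG : Continuous fun p : ℝ × X ↦ G p.1 p.2)
    {M : ℝ} (hM : ∀ σ x, ‖G σ x‖ ≤ M) {h : X → ℂ} (hh : Integrable h μ) {t : ℝ} (ht : 0 ≤ t) :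
    ∫ x, (∫ σ in (0 : ℝ)..t, G σ x) * h x ∂μ = ∫ σ in (0 : ℝ)..t, ∫ x, G σ x * h x ∂μ := by
  simp only [intervalIntegral.integral_of_le ht]
  rw [integral_integral_swap]
  · simp only [integral_mul_const]
  · have h1 : Integrable (fun p : ℝ × X ↦ h p.2) ((volume.restrict (Ioc 0 t)).prod μ) :=
      hh.comp_snd _
    exact h1.bdd_mul (c := M) hG.aestronglyMeasurable (.of_forall fun p ↦ hM _ _)

theorem integral_triangle_swap {K : ℝ → ℝ → ℂ} (hK : Continuous fun p : ℝ × ℝ ↦ K p.1 p.2)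
    {t : ℝ} (ht : 0 ≤ t) :
    ∫ τ in (0 : ℝ)..t, ∫ σ in (0 : ℝ)..τ, K σ τ = ∫ σ in (0 : ℝ)..t, ∫ τ in σ..t, K σ τ := by
  have h1 : ∀ τ ∈ Ioc 0 t, ∫ σ in (0 : ℝ)..τ, K σ τ
      = ∫ σ in Ioc 0 t, {p : ℝ × ℝ | p.1 ≤ p.2}.indicator (fun p ↦ K p.1 p.2) (σ, τ) := by
    intro τ hτ
    rw [intervalIntegral.integral_of_le hτ.1.le, ← integral_indicator measurableSet_Ioc,
      ← integral_indicator measurableSet_Ioc]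
    congr 1
    ext σ
    simp only [indicator_apply, mem_Ioc, mem_ofPred_eq]
    have := hτ.2
    grind
  have h2 : ∀ σ ∈ Ioc 0 t, ∫ τ in σ..t, K σ τ
      = ∫ τ in Ioc 0 t, {p : ℝ × ℝ | p.1 ≤ p.2}.indicator (fun p ↦ K p.1 p.2) (σ, τ) := by
    intro σ hσ
    -- The triangle is `σ ≤ τ`, so the endpoint `τ = σ` has to be included before comparing
    -- indicators.
    rw [intervalIntegral.integral_of_le hσ.2, ← integral_Icc_eq_integral_Ioc,
      ← integral_indicator measurableSet_Icc, ← integral_indicator measurableSet_Ioc]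
    congr 1
    ext τ
    simp only [indicator_apply, mem_Ioc, mem_Icc, mem_ofPred_eq]
    have := hσ.1
    grind
  rw [intervalIntegral.integral_of_le ht, intervalIntegral.integral_of_le ht,
    setIntegral_congr_fun measurableSet_Ioc h1, setIntegral_congr_fun measurableSet_Ioc h2]
  refine (integral_integral_swap (f := fun σ τ ↦
    {p : ℝ × ℝ | p.1 ≤ p.2}.indicator (fun p ↦ K p.1 p.2) (σ, τ)) ?_).symm
  refine Integrable.indicator ?_ (measurableSet_le measurable_fst measurable_snd)
  rw [Measure.prod_restrict]
  exact (hK.continuousOn.integrableOn_compact (isCompact_Icc.prod isCompact_Icc)).mono_set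
    (prod_mono Ioc_subset_Icc_self Ioc_subset_Icc_self)

/-- A convolution integrand of two `L¹` functions times a bounded factor. It justifies Fubini for
the symmetry and the semigroup law, and with `f = 1` gives `L¹` stability. -/
theorem integrable_mul_heatKernel_mul {t : ℝ} (ht : 0 < t) {h f : Space N → ℂ} (hh : Integrable h)
    (hf : Continuous f) {M : ℝ} (hM : ∀ y, ‖f y‖ ≤ M) :
    Integrable fun p : Space N × Space N ↦ h p.2 * (heatKernel t (p.1 - p.2) : ℂ) * f p.1 := by
  have h1 := hh.convolution_integrand (ContinuousLinearMap.mul ℂ ℂ)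
    ((integrable_heatKernel (N := N) ht).ofReal (𝕜 := ℂ))
  exact h1.mul_bdd (c := M) (hf.comp continuous_fst).aestronglyMeasurable
    (.of_forall fun p ↦ hM _)

/-- The heat semigroup is symmetric. -/
theorem integral_heatSemigroup_mul (t : ℝ) {h f : Space N → ℂ} (hh : Integrable h)
    (hf : Continuous f) {M : ℝ} (hM : ∀ y, ‖f y‖ ≤ M) :
    ∫ x, heatSemigroup t f x * h x = ∫ x, f x * heatSemigroup t h x := by
  by_cases ht : 0 < t
  · have h1 := integral_integral_swap
      (f := fun y x ↦ h x * (heatKernel t (y - x) : ℂ) * f y)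
      (integrable_mul_heatKernel_mul ht hh hf hM)
    simp only [heatSemigroup, if_pos ht]
    simp only [← integral_mul_const, ← integral_const_mul]
    calc _ = ∫ x, ∫ y, h x * (heatKernel t (y - x) : ℂ) * f y := by
          congr 1; ext x; congr 1; ext y
          rw [← heatKernel_neg t (y - x), neg_sub]; ring
      _ = ∫ y, ∫ x, h x * (heatKernel t (y - x) : ℂ) * f y := h1.symm
      _ = _ := by
          congr 1; ext x; congr 1; ext y
          ring
  · simp [heatSemigroup, ht]

theorem fourier_heatKernel {t : ℝ} (ht : 0 < t) (ξ : Space N) :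
    𝓕 (fun y : Space N ↦ (heatKernel t y : ℂ)) ξ
      = Complex.exp (-((4 * Real.pi ^ 2 * t : ℝ) : ℂ) * ‖ξ‖ ^ 2) := by
  have hpi := Real.pi_pos
  have h1 : (fun y : Space N ↦ (heatKernel t y : ℂ))
      = (((4 * Real.pi * t) ^ (-(N : ℝ) / 2) : ℝ) : ℂ) •
        fun y : Space N ↦ Complex.exp (-(((4 * t)⁻¹ : ℝ) : ℂ) * ‖y‖ ^ 2) := by
    ext y
    rw [heatKernel_eq]
    simp
  have h4 (c : ℂ) (g : Space N → ℂ) : 𝓕 (c • g) ξ = c • 𝓕 g ξ :=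
    congrFun (VectorFourier.fourierIntegral_const_smul _ _ _ _ _) ξ
  rw [h1, h4,
    fourier_gaussian_innerProductSpace (by rw [Complex.ofReal_re]; positivity),
    finrank_euclideanSpace_fin, smul_eq_mul, ← mul_assoc]
  have h2 : (((4 * Real.pi * t) ^ (-(N : ℝ) / 2) : ℝ) : ℂ)
      * (Real.pi / ((4 * t)⁻¹ : ℝ)) ^ ((N : ℂ) / 2) = 1 := by
    rw [Complex.ofReal_cpow (by positivity)]
    have h3 : (Real.pi : ℂ) / ((4 * t)⁻¹ : ℝ) = ((4 * Real.pi * t : ℝ) : ℂ) := by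
      push_cast
      field_simp
    rw [h3, ← Complex.cpow_add _ _ (by exact_mod_cast (by positivity : 4 * Real.pi * t ≠ 0))]
    push_cast
    ring_nf
    simp
  rw [h2, one_mul]
  congr 1
  push_cast
  field_simp

/-- On the Fourier side the Gaussian exponents add. -/
theorem integral_heatKernel_mul_heatKernel {t s : ℝ} (ht : 0 < t) (hs : 0 < s) (x : Space N) :
    ∫ y, (heatKernel t (x - y) : ℂ) * heatKernel s y = heatKernel (t + s) x := by
  have h1 := heatSemigroup_eq_fourier ht ((integrable_heatKernel (N := N) hs).ofReal (𝕜 := ℂ)) x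
  rw [heatSemigroup, if_pos ht] at h1
  refine h1.trans ?_
  have h2 := fourier_gaussianPhase (N := N) (add_pos ht hs) x 0
  rw [sub_zero] at h2
  rw [← h2, Real.fourier_eq']
  congr 1
  ext ξ
  rw [show (fun a : Space N ↦ (RCLike.ofReal (heatKernel s a) : ℂ))
    = fun a ↦ (heatKernel s a : ℂ) from rfl, fourier_heatKernel hs, ← Complex.exp_add]
  simp
  congr 1
  ring

theorem heatSemigroup_heatSemigroup {t s : ℝ} (ht : 0 ≤ t) (hs : 0 ≤ s) {f : Space N → ℂ}
    (hf : Continuous f) {M : ℝ} (hM : ∀ y, ‖f y‖ ≤ M) (x : Space N) :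
    heatSemigroup t (fun y ↦ heatSemigroup s f y) x = heatSemigroup (t + s) f x := by
  rcases ht.eq_or_lt with rfl | ht
  · simp [heatSemigroup]
  rcases hs.eq_or_lt with rfl | hs
  · simp [heatSemigroup]
  simp only [heatSemigroup, if_pos ht, if_pos hs, if_pos (add_pos ht hs)]
  have h0 : Integrable fun y : Space N ↦ (heatKernel t (x - y) : ℂ) :=
    ((integrable_heatKernel ht).comp_sub_left x).ofReal
  have h1 := integral_integral_swap
      (f := fun z y ↦ (heatKernel t (x - y) : ℂ) * (heatKernel s (z - y) : ℂ) * f z)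
      (integrable_mul_heatKernel_mul hs h0 hf hM)
  simp only [← integral_const_mul]
  calc _ = ∫ y, ∫ z, (heatKernel t (x - y) : ℂ) * (heatKernel s (z - y) : ℂ) * f z := by
        congr 1; ext y; congr 1; ext z
        rw [← heatKernel_neg s (y - z), neg_sub, mul_assoc]
    _ = _ := h1.symm
    _ = _ := by
        congr 1; ext z
        rw [integral_mul_const]
        congr 1
        rw [← integral_heatKernel_mul_heatKernel ht hs, ← integral_add_right_eq_self
          (fun y ↦ (heatKernel t (x - y) : ℂ) * heatKernel s (z - y)) z]
        congr 1; ext y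
        rw [← heatKernel_neg s (z - (y + z)), neg_sub, add_sub_cancel_right, sub_add_eq_sub_sub_swap]

end NLHeat

/-! ### From Duhamel's formula to the distributional equation -/

namespace NLHeat

variable {N : ℕ}

open FourierTransform Laplacian

/-- Under the Fourier integral this is the fundamental theorem of calculus in time for the
multiplier `exp(-4π² r |ξ|²)`, whose `r`-derivative brings out the symbol of `Δ`. -/
theorem heatSemigroup_sub_self (h : 𝓢(Space N, ℂ)) {t : ℝ} (ht : 0 ≤ t) (x : Space N) :
    heatSemigroup t h x - h x
      = ∫ r in (0 : ℝ)..t, heatSemigroup r (Δ h : 𝓢(Space N, ℂ)) x := by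
  rcases ht.eq_or_lt with rfl | ht'
  · simp [heatSemigroup]
  set e : ℝ → Space N → ℂ := fun r ξ ↦ Complex.exp (-((4 * Real.pi ^ 2 * r : ℝ) : ℂ) * ‖ξ‖ ^ 2
      + 2 * Real.pi * Complex.I * inner ℝ x ξ) with he
  have hec : Continuous fun p : ℝ × Space N ↦ e p.1 p.2 := by
    simp only [he]
    have : Continuous fun p : ℝ × Space N ↦ inner ℝ x p.2 := by fun_prop
    fun_prop
  have heb : ∀ r, 0 ≤ r → ∀ ξ, ‖e r ξ‖ ≤ 1 := by
    intro r hr ξ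
    rw [he, Complex.norm_exp, Real.exp_le_one_iff]
    have : (-((4 * Real.pi ^ 2 * r : ℝ) : ℂ) * ‖ξ‖ ^ 2
      + 2 * Real.pi * Complex.I * inner ℝ x ξ)
      = ((-(4 * Real.pi ^ 2 * r) * ‖ξ‖ ^ 2 : ℝ) : ℂ)
        + ((2 * Real.pi * inner ℝ x ξ : ℝ) : ℂ) * Complex.I := by push_cast; ring
    rw [this, Complex.add_re, Complex.ofReal_re, Complex.re_ofReal_mul, Complex.I_re]
    have : 0 ≤ 4 * Real.pi ^ 2 * r * ‖ξ‖ ^ 2 := by positivity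
    linarith
  have hint (g : 𝓢(Space N, ℂ)) : Integrable (𝓕 g : 𝓢(Space N, ℂ)) := (𝓕 g).integrable
  have hx : h x = ∫ ξ, e 0 ξ * 𝓕 h ξ := by
    conv_lhs => rw [← FourierTransform.fourierInv_fourier_eq (F := 𝓢(Space N, ℂ)) h,
      SchwartzMap.fourierInv_coe,
      Real.fourierInv_eq']
    congr 1
    ext ξ
    simp only [he, smul_eq_mul]
    congr 2
    rw [real_inner_comm]
    push_cast
    ring
  have hheat : ∀ g : 𝓢(Space N, ℂ), ∀ r > 0, heatSemigroup r g x = ∫ ξ, e r ξ * 𝓕 g ξ := by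
    intro g r hr
    rw [heatSemigroup_eq_fourier hr g.integrable]
    congr 1
    ext ξ
    rw [mul_comm]
    rfl
  -- The multiplier is bounded by `1` only for nonnegative times; `|r|` makes the bound global, as
  -- the Fubini lemma requires.
  have h1 : ∫ r in (0 : ℝ)..t, heatSemigroup r (Δ h : 𝓢(Space N, ℂ)) x
      = ∫ r in (0 : ℝ)..t, ∫ ξ, e |r| ξ * 𝓕 (Δ h : 𝓢(Space N, ℂ)) ξ := by
    rw [intervalIntegral.integral_of_le ht, intervalIntegral.integral_of_le ht]
    refine setIntegral_congr_fun measurableSet_Ioc fun r hr ↦ ?_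
    rw [hheat _ r hr.1, abs_of_pos hr.1]
  rw [h1, ← integral_intervalIntegral_mul_swap (G := fun r ξ ↦ e |r| ξ) (M := 1) ?_
    (fun r ξ ↦ heb _ (abs_nonneg r) ξ) (hint _) ht, hheat h t ht', hx, ← integral_sub]
  · congr 1
    ext ξ
    rw [fourier_laplacian, ← mul_assoc, ← sub_mul]
    congr 1
    have h2 : ∀ r ∈ uIcc 0 t, HasDerivAt (fun r ↦ e r ξ)
        (e r ξ * (-((2 * Real.pi) ^ 2 * ‖ξ‖ ^ 2 : ℝ) : ℂ)) r := by
      intro r _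
      simp only [he]
      refine HasDerivAt.cexp ?_
      have h3 : HasDerivAt (fun r : ℝ ↦ (r : ℂ)) 1 r := Complex.ofRealCLM.hasDerivAt
      have h4 := (h3.mul_const (-((2 * Real.pi) ^ 2 * ‖ξ‖ ^ 2 : ℝ) : ℂ)).add_const
        (2 * Real.pi * Complex.I * inner ℝ x ξ)
      rw [one_mul] at h4
      refine h4.congr_of_eventuallyEq (.of_forall fun r ↦ ?_)
      simp only
      push_cast
      ring
    rw [← intervalIntegral.integral_mul_const]
    have h5 : Continuous fun r ↦ e r ξ :=
      hec.comp (f := fun r ↦ (r, ξ)) (by fun_prop)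
    rw [← intervalIntegral.integral_eq_sub_of_hasDerivAt h2
      ((h5.mul continuous_const).intervalIntegrable _ _)]
    refine intervalIntegral.integral_congr fun r hr ↦ ?_
    rw [uIcc_of_le ht] at hr
    rw [abs_of_nonneg hr.1]
  · exact (hint h).bdd_mul (c := 1) (hec.comp (f := fun ξ ↦ (t, ξ)) (by fun_prop)).aestronglyMeasurable
      (.of_forall (heb t ht))
  · exact (hint h).bdd_mul (c := 1) (hec.comp (f := fun ξ ↦ ((0 : ℝ), ξ)) (by fun_prop)).aestronglyMeasurable
      (.of_forall (heb 0 le_rfl))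
  · exact hec.comp (f := fun p : ℝ × Space N ↦ (|p.1|, p.2)) (by fun_prop)

theorem integrable_heatSemigroup (t : ℝ) {h : Space N → ℂ} (hh : Integrable h) :
    Integrable (heatSemigroup t h : Space N → ℂ) := by
  by_cases ht : 0 < t
  · have := (integrable_mul_heatKernel_mul ht hh (f := fun _ ↦ (1 : ℂ))
      continuous_const (M := 1) (by simp)).integral_prod_left
    refine this.congr (.of_forall fun x ↦ ?_)
    simp only [heatSemigroup, if_pos ht, mul_one]
    congr 1
    ext y
    ring
  · have : (heatSemigroup t h : Space N → ℂ) = h := by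
      ext x
      simp [heatSemigroup, ht]
    rwa [this]

theorem ofReal_norm_heatSemigroup_le (t : ℝ) (h : Space N → ℂ) (x : Space N) :
    ‖heatSemigroup t h x‖ ≤ (heatSemigroup t (fun y ↦ (‖h y‖ : ℂ)) x).re := by
  rw [heatSemigroup_eq, heatSemigroup_eq]
  refine (norm_integral_le_integral_norm _).trans ?_
  simp only [← Complex.ofReal_mul]
  rw [integral_complex_ofReal, Complex.ofReal_re]
  refine le_of_eq (congrArg _ (funext fun z ↦ ?_))
  rw [norm_mul, Complex.norm_real, Real.norm_of_nonneg (heatKernel_pos one_pos z).le]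

/-- Pair `‖h‖` with the constant `1`, which the semigroup fixes, and use symmetry. -/
theorem integral_norm_heatSemigroup_le (t : ℝ) {h : Space N → ℂ} (hh : Integrable h) :
    ∫ x, ‖heatSemigroup t h x‖ ≤ ∫ x, ‖h x‖ := by
  have h0 : Integrable fun y ↦ (‖h y‖ : ℂ) := hh.norm.ofReal
  have h1 := integral_heatSemigroup_mul t h0 (f := fun _ ↦ (1 : ℂ))
    continuous_const (M := 1) (by simp)
  have h2 (x : Space N) : heatSemigroup t (fun _ ↦ (1 : ℂ)) x = 1 := by
    rw [heatSemigroup_eq, integral_mul_const, integral_complex_ofReal, integral_heatKernel one_pos]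
    simp
  have h3 := integrable_heatSemigroup t h0
  simp only [h2, one_mul] at h1
  calc ∫ x, ‖heatSemigroup t h x‖ ≤ ∫ x, (heatSemigroup t (fun y ↦ (‖h y‖ : ℂ)) x).re :=
        integral_mono (integrable_heatSemigroup t hh).norm h3.re
          (ofReal_norm_heatSemigroup_le t h)
    _ = (∫ x, heatSemigroup t (fun y ↦ (‖h y‖ : ℂ)) x).re := integral_re h3
    _ = ∫ x, ‖h x‖ := by rw [← h1, integral_complex_ofReal, Complex.ofReal_re]

/-- By symmetry the semigroup acts on the test function, where `heatSemigroup_sub_self` applies even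
though `f` is only bounded and continuous. -/
theorem integral_heatSemigroup_mul_sub (h : 𝓢(Space N, ℂ)) {f : Space N → ℂ} (hf : Continuous f)
    {M : ℝ} (hM : ∀ y, ‖f y‖ ≤ M) {t : ℝ} (ht : 0 ≤ t) :
    (∫ x, heatSemigroup t f x * h x) - ∫ x, f x * h x
      = ∫ r in (0 : ℝ)..t, ∫ x, heatSemigroup r f x * (Δ h : 𝓢(Space N, ℂ)) x := by
  have hi (g : 𝓢(Space N, ℂ)) : Integrable g := g.integrable
  have hcont : Continuous fun p : ℝ × Space N ↦ heatSemigroup p.1 (Δ h : 𝓢(Space N, ℂ)) p.2 :=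
    continuous_heatSemigroup (X := ℝ × Space N) (F := fun _ ↦ (Δ h : 𝓢(Space N, ℂ)))
      ((Δ h : 𝓢(Space N, ℂ)).continuous.comp continuous_snd)
      (fun _ x ↦ (Δ h : 𝓢(Space N, ℂ)).toBoundedContinuousFunction.norm_coe_le_norm x)
      continuous_fst continuous_snd
  have hmul (r : ℝ) (g : 𝓢(Space N, ℂ)) : Integrable fun x ↦ f x * heatSemigroup r g x :=
    (integrable_heatSemigroup r (hi g)).bdd_mul hf.aestronglyMeasurable (.of_forall hM)
  have hfi : Integrable fun x ↦ f x * h x :=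
    (hi h).bdd_mul hf.aestronglyMeasurable (.of_forall hM)
  simp only [integral_heatSemigroup_mul _ (hi _) hf hM]
  rw [intervalIntegral.integral_of_le ht, integral_integral_swap, ← integral_sub (hmul t h) hfi]
  · congr 1
    ext x
    rw [integral_const_mul, ← intervalIntegral.integral_of_le ht, ← heatSemigroup_sub_self h ht,
      mul_sub]
  · have hc : Continuous fun p : ℝ × Space N ↦
        f p.2 * heatSemigroup p.1 (Δ h : 𝓢(Space N, ℂ)) p.2 :=
      (hf.comp continuous_snd).mul hcont
    refine (integrable_prod_iff hc.aestronglyMeasurable).2 ?_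
    refine ⟨.of_forall fun r ↦ hmul r _, ?_⟩
    refine Integrable.mono' (integrable_const (M * ∫ x, ‖(Δ h : 𝓢(Space N, ℂ)) x‖))
      (hc.norm.aestronglyMeasurable.integral_prod_right') (.of_forall fun r ↦ ?_)
    rw [Real.norm_of_nonneg (integral_nonneg fun x ↦ norm_nonneg _)]
    have hM0 : 0 ≤ M := (norm_nonneg _).trans (hM 0)
    calc ∫ x, ‖f x * heatSemigroup r (Δ h : 𝓢(Space N, ℂ)) x‖
        ≤ ∫ x, M * ‖heatSemigroup r (Δ h : 𝓢(Space N, ℂ)) x‖ := by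
          refine integral_mono (hmul r _).norm
            ((integrable_heatSemigroup r (hi _)).norm.const_mul M) fun x ↦ ?_
          simp only [norm_mul]
          exact mul_le_mul_of_nonneg_right (hM x) (norm_nonneg _)
      _ ≤ _ := by
          rw [integral_const_mul]
          exact mul_le_mul_of_nonneg_left (integral_norm_heatSemigroup_le r (hi _)) hM0

namespace IsMild

variable {α T M : ℝ} {lam : ℂ} {φ : Space N → ℂ} {u : ℝ → Space N → ℂ}

theorem continuous_integral_heatSemigroup_mul (hα : 0 < α) (hu : IsMild α lam φ T M u)
    (h : 𝓢(Space N, ℂ)) :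
    Continuous fun p : ℝ × ℝ ↦
      ∫ x, heatSemigroup p.1 (fun y ↦ powNl α (u p.2 y)) x * h x := by
  have hi : Integrable h := h.integrable
  have hc := hu.cont_integrand hα
  refine continuous_of_dominated (bound := fun x ↦ M ^ α * M * ‖h x‖) ?_ ?_ ?_ ?_
  · intro p
    refine Continuous.aestronglyMeasurable (Continuous.mul ?_ h.continuous)
    exact hc.comp (f := fun x ↦ (p.1, p.2, x)) (by fun_prop)
  · intro p
    refine .of_forall fun x ↦ ?_
    rw [norm_mul]
    exact mul_le_mul_of_nonneg_right (norm_heatSemigroup_le _ (hu.bound_powNl hα _) _)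
      (norm_nonneg _)
  · exact hi.norm.const_mul _
  · refine .of_forall fun x ↦ Continuous.mul ?_ continuous_const
    exact hc.comp (f := fun p : ℝ × ℝ ↦ (p.1, p.2, x)) (by fun_prop)

theorem integral_mul_eq (hα : 0 < α) (hu : IsMild α lam φ T M u) (hφ : Continuous φ)
    {A : ℝ} (hA : ∀ x, ‖φ x‖ ≤ A) (h : 𝓢(Space N, ℂ)) {t : ℝ} (ht : t ∈ Icc 0 T) :
    ∫ x, u t x * h x = (∫ x, heatSemigroup t φ x * h x)
      + lam * ∫ σ in (0 : ℝ)..t, ∫ x,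
        heatSemigroup (t - σ) (fun y ↦ powNl α (u σ y)) x * h x := by
  have hi : Integrable h := h.integrable
  have hc : Continuous fun p : ℝ × Space N ↦
      heatSemigroup (t - p.1) (fun y ↦ powNl α (u p.1 y)) p.2 :=
    (hu.cont_integrand hα).comp (f := fun p : ℝ × Space N ↦ (t - p.1, p.1, p.2)) (by fun_prop)
  have hb : ∀ σ x, ‖heatSemigroup (t - σ) (fun y ↦ powNl α (u σ y)) x‖ ≤ M ^ α * M :=
    fun σ x ↦ norm_heatSemigroup_le _ (hu.bound_powNl hα σ) x
  rw [← integral_intervalIntegral_mul_swap hc hb hi ht.1, ← integral_const_mul, ← integral_add]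
  · congr 1
    ext x
    rw [hu.duhamel t ht]
    ring
  · refine hi.bdd_mul (c := A) ?_ (.of_forall fun x ↦ norm_heatSemigroup_le t hA x)
    refine Continuous.aestronglyMeasurable ?_
    exact continuous_heatSemigroup (F := fun _ ↦ φ) (hφ.comp continuous_snd) (fun _ ↦ hA)
      continuous_const continuous_id
  · refine Integrable.const_mul (hi.bdd_mul (c := M ^ α * M * t) ?_ (.of_forall fun x ↦ ?_)) _
    · refine Continuous.aestronglyMeasurable ?_
      exact intervalIntegral.continuous_parametric_intervalIntegral_of_continuous'
        (f := fun x σ ↦ heatSemigroup (t - σ) (fun y ↦ powNl α (u σ y)) x)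
        (hc.comp (f := fun p : Space N × ℝ ↦ (p.2, p.1)) (by fun_prop)) 0 t
    · refine (intervalIntegral.norm_integral_le_of_norm_le_const fun σ _ ↦ hb σ x).trans ?_
      rw [sub_zero, abs_of_nonneg ht.1]

/-- The distributional form of the equation. -/
theorem weak_form (hα : 0 < α) (hu : IsMild α lam φ T M u) (hφ : Continuous φ)
    {A : ℝ} (hA : ∀ x, ‖φ x‖ ≤ A) (h : 𝓢(Space N, ℂ)) {t : ℝ} (ht : t ∈ Icc 0 T) :
    (∫ x, u t x * h x) - ∫ x, φ x * h x
      = (∫ τ in (0 : ℝ)..t, ∫ x, u τ x * (Δ h : 𝓢(Space N, ℂ)) x)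
        + lam * ∫ τ in (0 : ℝ)..t, ∫ x, powNl α (u τ x) * h x := by
  set Q : 𝓢(Space N, ℂ) → ℝ → ℝ → ℂ := fun g r σ ↦
    ∫ x, heatSemigroup r (fun y ↦ powNl α (u σ y)) x * g x with hQ
  have hQc : ∀ g, Continuous fun p : ℝ × ℝ ↦ Q g p.1 p.2 :=
    fun g ↦ hu.continuous_integral_heatSemigroup_mul hα g
  have hsub : ∀ σ r, 0 ≤ r → ∫ ρ in (0 : ℝ)..r, Q (Δ h : 𝓢(Space N, ℂ)) ρ σ
      = Q h r σ - ∫ x, powNl α (u σ x) * h x := fun σ r hr ↦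
    (integral_heatSemigroup_mul_sub h (hu.cont_powNl_space hα σ)
      (hu.bound_powNl hα σ) hr).symm
  have hQ0 : ∀ σ, ∫ x, powNl α (u σ x) * h x = Q h 0 σ := by
    intro σ
    simp [hQ, heatSemigroup]
  have h1 : ∫ τ in (0 : ℝ)..t, ∫ x, u τ x * (Δ h : 𝓢(Space N, ℂ)) x
      = (∫ τ in (0 : ℝ)..t, ∫ x, heatSemigroup τ φ x * (Δ h : 𝓢(Space N, ℂ)) x)
        + lam * ∫ τ in (0 : ℝ)..t, ∫ σ in (0 : ℝ)..τ, Q (Δ h : 𝓢(Space N, ℂ)) (τ - σ) σ := by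
    rw [← intervalIntegral.integral_const_mul, ← intervalIntegral.integral_add]
    · refine intervalIntegral.integral_congr fun τ hτ ↦ ?_
      rw [uIcc_of_le ht.1] at hτ
      exact hu.integral_mul_eq hα hφ hA _ ⟨hτ.1, hτ.2.trans ht.2⟩
    · refine Continuous.intervalIntegrable ?_ _ _
      have hi : Integrable (Δ h : 𝓢(Space N, ℂ)) := (Δ h : 𝓢(Space N, ℂ)).integrable
      have hc : Continuous fun p : ℝ × Space N ↦ heatSemigroup p.1 φ p.2 :=
        continuous_heatSemigroup (X := ℝ × Space N) (F := fun _ ↦ φ) (hφ.comp continuous_snd)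
          (fun _ ↦ hA) continuous_fst continuous_snd
      refine continuous_of_dominated (bound := fun x ↦ A * ‖(Δ h : 𝓢(Space N, ℂ)) x‖) ?_ ?_ ?_ ?_
      · intro τ
        exact ((hc.comp (f := fun x ↦ (τ, x)) (by fun_prop)).mul
          (SchwartzMap.continuous _)).aestronglyMeasurable
      · refine fun τ ↦ .of_forall fun x ↦ ?_
        rw [norm_mul]
        exact mul_le_mul_of_nonneg_right (norm_heatSemigroup_le _ hA _) (norm_nonneg _)
      · exact hi.norm.const_mul _
      · refine .of_forall fun x ↦ ?_
        exact (hc.comp (f := fun τ ↦ (τ, x)) (by fun_prop)).mul continuous_const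
    · refine Continuous.intervalIntegrable ?_ _ _
      refine continuous_const.mul ?_
      have := intervalIntegral.continuous_parametric_intervalIntegral_of_continuous (a₀ := 0)
        (μ := volume) (f := fun τ σ ↦ Q (Δ h : 𝓢(Space N, ℂ)) (τ - σ) σ) (s := fun τ : ℝ ↦ τ)
        ((hQc _).comp (f := fun p : ℝ × ℝ ↦ (p.1 - p.2, p.2)) (by fun_prop)) continuous_id
      exact this
  -- Integrating over `τ` first on the triangle, the Laplacian integrates to a difference by `hsub`;
  -- the boundary term at `τ = σ` is the local nonlinear term.
  have h2 : ∫ τ in (0 : ℝ)..t, ∫ σ in (0 : ℝ)..τ, Q (Δ h : 𝓢(Space N, ℂ)) (τ - σ) σ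
      = (∫ σ in (0 : ℝ)..t, Q h (t - σ) σ) - ∫ σ in (0 : ℝ)..t, Q h 0 σ := by
    rw [integral_triangle_swap (K := fun σ τ ↦ Q (Δ h : 𝓢(Space N, ℂ)) (τ - σ) σ)
      ((hQc _).comp (f := fun p : ℝ × ℝ ↦ (p.2 - p.1, p.1)) (by fun_prop)) ht.1,
      ← intervalIntegral.integral_sub]
    · refine intervalIntegral.integral_congr fun σ hσ ↦ ?_
      rw [uIcc_of_le ht.1] at hσ
      rw [intervalIntegral.integral_comp_sub_right (fun ρ ↦ Q (Δ h : 𝓢(Space N, ℂ)) ρ σ) σ,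
        sub_self, hsub σ _ (sub_nonneg.2 hσ.2), hQ0]
    · exact ((hQc h).comp (f := fun σ : ℝ ↦ (t - σ, σ)) (by fun_prop)).intervalIntegrable _ _
    · exact ((hQc h).comp (f := fun σ : ℝ ↦ ((0 : ℝ), σ)) (by fun_prop)).intervalIntegrable _ _
  have h3 := integral_heatSemigroup_mul_sub h hφ hA ht.1
  have h4 : ∫ x, u t x * h x = (∫ x, heatSemigroup t φ x * h x)
      + lam * ∫ σ in (0 : ℝ)..t, Q h (t - σ) σ := hu.integral_mul_eq hα hφ hA h ht
  rw [h1, h2, ← h3, h4]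
  simp only [hQ0]
  ring

end IsMild

end NLHeat

/-! ### Duality for `H^s` on the Fourier side -/

namespace NLHeat

variable {N : ℕ}

open FourierTransform Laplacian

theorem toDistribution_apply (f : C₀(Space N, ℂ)) (h : 𝓢(Space N, ℂ)) :
    toDistribution f h = ∫ x, h x * f x := by
  rw [toDistribution, Lp.toTemperedDistribution_apply]
  refine integral_congr_ae ?_
  filter_upwards [(f.toBCF.memLp_top (μ := volume)).coeFn_toLp] with x hx
  rw [hx]
  rfl

/-- The square of the `H^s` norm of a Schwartz function, on the Fourier side. -/
noncomputable def hsEnergy (s : ℝ) (h : 𝓢(Space N, ℂ)) : ℝ :=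
  ∫ ξ, (1 + ‖ξ‖ ^ 2) ^ s * ‖𝓕 h ξ‖ ^ 2

theorem hasTemperateGrowth_bessel (s : ℝ) :
    (fun x : Space N ↦ (((1 + ‖x‖ ^ 2) ^ (s / 2) : ℝ) : ℂ)).HasTemperateGrowth := by
  fun_prop

theorem norm_sq_smulLeftCLM_bessel (s : ℝ) (h : 𝓢(Space N, ℂ)) (ξ : Space N) :
    ‖SchwartzMap.smulLeftCLM ℂ (fun x : Space N ↦ (((1 + ‖x‖ ^ 2) ^ (s / 2) : ℝ) : ℂ)) h ξ‖ ^ 2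
      = (1 + ‖ξ‖ ^ 2) ^ s * ‖h ξ‖ ^ 2 := by
  rw [SchwartzMap.smulLeftCLM_apply_apply (hasTemperateGrowth_bessel s), smul_eq_mul, norm_mul,
    mul_pow, Complex.norm_real, Real.norm_of_nonneg (by positivity), ← Real.rpow_natCast,
    ← Real.rpow_mul (by positivity)]
  congr 2
  push_cast
  ring

theorem integrable_bessel_mul (s : ℝ) (h : 𝓢(Space N, ℂ)) :
    Integrable fun ξ ↦ (1 + ‖ξ‖ ^ 2) ^ s * ‖h ξ‖ ^ 2 := by
  simp only [← norm_sq_smulLeftCLM_bessel]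
  exact (memLp_two_iff_integrable_sq_norm (SchwartzMap.continuous _).aestronglyMeasurable).1
    (SchwartzMap.memLp _ 2 _)

theorem fourierInv_eq_fourier_neg (h : 𝓢(Space N, ℂ)) (ξ : Space N) : 𝓕⁻ h ξ = 𝓕 h (-ξ) := by
  rw [SchwartzMap.fourierInv_coe, SchwartzMap.fourier_coe, Real.fourierInv_eq_fourier_neg]

theorem norm_integral_mul_le (k : 𝓢(Space N, ℂ)) (g : Lp ℂ 2 (volume : Measure (Space N))) :
    ‖∫ x, k x * g x‖ ≤ ‖g‖ * √(∫ x, ‖k x‖ ^ 2) := by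
  have h2 : ENNReal.ofReal 2 = 2 := by simp
  refine (norm_integral_le_integral_norm _).trans ?_
  simp only [norm_mul]
  have h := integral_mul_norm_le_Lp_mul_Lq (μ := (volume : Measure (Space N)))
    Real.HolderConjugate.two_two (f := k) (g := g)
    (by rw [h2]; exact k.memLp 2 _) (by rw [h2]; exact Lp.memLp g)
  have hg : ‖g‖ = (∫ a, ‖g a‖ ^ (2 : ℝ)) ^ (1 / 2 : ℝ) := by
    rw [Lp.norm_def, (Lp.memLp g).eLpNorm_eq_integral_rpow_norm (by simp) (by simp),
      ENNReal.toReal_ofReal (by positivity)]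
    simp
  rw [hg, mul_comm, Real.sqrt_eq_rpow]
  simpa only [Real.rpow_two] using h

/-- An `H^s` function defines a functional that is bounded in the `H^{-s}` norm. -/
theorem MemHs.exists_bound {s : ℝ} {f : C₀(Space N, ℂ)} (hf : MemHs s f) :
    ∃ M : ℝ, 0 ≤ M ∧ ∀ h : 𝓢(Space N, ℂ), ‖∫ x, f x * h x‖ ≤ M * √(hsEnergy (-s) h) := by
  obtain ⟨g, hg⟩ := hf
  -- Write `f` as the Bessel potential of order `-s` of `g ∈ L²`, then move that potential onto `h`
  -- and use Cauchy–Schwarz and Plancherel.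
  rw [← besselPotential_neg_apply_eq_iff] at hg
  refine ⟨‖g‖, norm_nonneg _, fun h ↦ ?_⟩
  have h1 : ∫ x, f x * h x = toDistribution f h := by
    rw [toDistribution_apply]
    simp only [mul_comm]
  rw [h1, ← hg, besselPotential, fourierMultiplierCLM_apply_apply,
    Lp.toTemperedDistribution_apply]
  simp only [smul_eq_mul]
  refine (norm_integral_mul_le _ g).trans ?_
  rw [SchwartzMap.integral_norm_sq_fourier]
  simp only [norm_sq_smulLeftCLM_bessel]
  rw [hsEnergy]
  refine le_of_eq (congrArg (fun r ↦ ‖g‖ * √r) ?_)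
  -- The dual multiplier involves `𝓕⁻` where `hsEnergy` uses `𝓕`; they differ by `ξ ↦ -ξ`.
  rw [← integral_neg_eq_self]
  simp [fourierInv_eq_fourier_neg]

theorem hsNorm_le_enorm {s : ℝ} {f : C₀(Space N, ℂ)} (g : Lp ℂ 2 (volume : Measure (Space N)))
    (hg : besselPotential (Space N) ℂ s (toDistribution f) = (g : 𝓢'(Space N, ℂ))) :
    hsNorm s f ≤ ‖g‖ₑ := by
  unfold hsNorm
  exact iInf₂_le g hg

theorem hsNorm_le {s : ℝ} {f : C₀(Space N, ℂ)} (h : 𝓢(Space N, ℂ)) (hf : ∀ x, f x = h x) :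
    hsNorm s f ≤ ENNReal.ofReal √(hsEnergy s h) := by
  have h1 : toDistribution f = (h : 𝓢'(Space N, ℂ)) := by
    ext g
    rw [toDistribution_apply, SchwartzMap.coe_apply]
    simp [hf]
  obtain ⟨k, hk⟩ : ∃ k : 𝓢(Space N, ℂ), k = SchwartzMap.fourierMultiplierCLM ℂ
    (fun x : Space N ↦ (((1 + ‖x‖ ^ 2) ^ (s / 2) : ℝ) : ℂ)) h := ⟨_, rfl⟩
  have h2 : besselPotential (Space N) ℂ s (toDistribution f)
      = ((k.toLp 2 : Lp ℂ 2 (volume : Measure (Space N))) : 𝓢'(Space N, ℂ)) := by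
    rw [besselPotential, h1, Lp.toTemperedDistribution_toLp_eq,
      fourierMultiplierCLM_toTemperedDistributionCLM_eq (hasTemperateGrowth_bessel s), hk]
  refine (hsNorm_le_enorm _ h2).trans ?_
  rw [← ofReal_norm]
  refine ENNReal.ofReal_le_ofReal (le_of_eq ?_)
  rw [SchwartzMap.norm_toLp' (by simp) (by simp), Real.sqrt_eq_rpow]
  simp only [ENNReal.toReal_ofNat, Real.rpow_two, one_div]
  congr 1
  rw [← SchwartzMap.integral_norm_sq_fourier k, hk, SchwartzMap.fourierMultiplierCLM_apply,
    FourierTransform.fourier_fourierInv_eq]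
  simp only [norm_sq_smulLeftCLM_bessel]
  rfl

end NLHeat

/-! ### Positivity and Jensen's inequality -/

namespace NLHeat

variable {N : ℕ} {α : ℝ}

/-- Clamping time to `[0, T₁]` gives a globally continuous function, bounded by compactness. -/
theorem IsSolutionOn.exists_isMild {lam : ℂ} {φ : C₀(Space N, ℂ)} {T : ℝ≥0∞}
    {u : ℝ → C₀(Space N, ℂ)} (hu : IsSolutionOn α lam φ T u) {T₁ : ℝ} (hT₁ : 0 ≤ T₁)
    (h : ENNReal.ofReal T₁ < T) :
    ∃ M, IsMild α lam φ T₁ M fun t x ↦ u (max 0 (min t T₁)) x := by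
  have hmem : ∀ t : ℝ, max 0 (min t T₁) ∈ {t : ℝ | 0 ≤ t ∧ ENNReal.ofReal t < T} := fun t ↦
    ⟨le_max_left _ _, (ENNReal.ofReal_le_ofReal (max_le hT₁ (min_le_right _ _))).trans_lt h⟩
  have hc : Continuous fun t : ℝ ↦ u (max 0 (min t T₁)) :=
    hu.continuousOn.comp_continuous (by fun_prop) hmem
  have hclamp : ∀ t ∈ Icc 0 T₁, max 0 (min t T₁) = t := fun t ht ↦ by
    rw [min_eq_left ht.2, max_eq_right ht.1]
  obtain ⟨M, hM⟩ := isCompact_Icc.exists_bound_of_continuousOn (s := Icc 0 T₁) hc.continuousOn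
  refine ⟨M, ?_, ?_, ?_⟩
  · have h1 : Continuous fun p : ℝ × Space N ↦ (u (max 0 (min p.1 T₁))).toBCF p.2 :=
      Continuous.eval ((ZeroAtInftyContinuousMap.isometry_toBCF.continuous.comp hc).comp
        continuous_fst) continuous_snd
    exact h1
  · intro t x
    have h1 := hM _ (⟨le_max_left _ _, max_le hT₁ (min_le_right _ _)⟩ :
      max 0 (min t T₁) ∈ Icc 0 T₁)
    rw [hclamp _ ⟨le_max_left _ _, max_le hT₁ (min_le_right _ _)⟩] at h1
    refine le_trans ?_ h1
    rw [← ZeroAtInftyContinuousMap.norm_toBCF_eq_norm]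
    exact (u (max 0 (min t T₁))).toBCF.norm_coe_le_norm x
  · intro t ht x
    rw [hclamp t ht, hu.duhamel t ht.1 ((ENNReal.ofReal_le_ofReal ht.2).trans_lt h)]
    congr 2
    refine intervalIntegral.integral_congr fun σ hσ ↦ ?_
    rw [uIcc_of_le ht.1] at hσ
    simp only [powNl, hclamp σ ⟨hσ.1, hσ.2.trans ht.2⟩]

theorem apply_heatSemigroup_le (ℓ : ℂ →L[ℝ] ℝ) (t : ℝ) {f : Space N → ℂ} (hf : Continuous f)
    {M : ℝ} (hM : ∀ y, ‖f y‖ ≤ M) {c : ℝ} (hc : ∀ y, ℓ (f y) ≤ c) (x : Space N) :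
    ℓ (heatSemigroup t f x) ≤ c := by
  have hi : Integrable fun z : Space N ↦ (heatKernel 1 z : ℂ) * f (x - √t • z) :=
    integrable_heatKernel_mul one_pos (by fun_prop) fun y ↦ hM _
  rw [heatSemigroup_eq, ← ContinuousLinearMap.integral_comp_comm ℓ hi]
  calc ∫ z : Space N, ℓ ((heatKernel 1 z : ℂ) * f (x - √t • z))
      ≤ ∫ z : Space N, heatKernel 1 z * c := by
        refine integral_mono (ℓ.integrable_comp hi)
          ((integrable_heatKernel one_pos).mul_const c) fun z ↦ ?_
        simp only
        rw [← Complex.real_smul, ℓ.map_smul, smul_eq_mul]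
        exact mul_le_mul_of_nonneg_left (hc _) (heatKernel_pos one_pos z).le
    _ = c := by rw [integral_mul_const, integral_heatKernel one_pos, one_mul]

namespace IsMild

variable {T M lam : ℝ} {φ : Space N → ℂ} {u : ℝ → Space N → ℂ}

/-- Half-planes containing the data and bounded by a line through the origin are invariant. -/
theorem apply_nonpos (hα : 0 < α) (hlam : 0 ≤ lam) (hu : IsMild α (lam : ℂ) φ T M u)
    (hφ : Continuous φ) {A : ℝ} (hA : ∀ x, ‖φ x‖ ≤ A) (ℓ : ℂ →L[ℝ] ℝ) (hℓ : ∀ x, ℓ (φ x) ≤ 0) :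
    ∀ t ∈ Icc 0 T, ∀ x, ℓ (u t x) ≤ 0 := by
  have hM := hu.nonneg
  -- The bootstrap is applied to the signed quantity `ℓ (u t x)` with `D = 0`. It closes because
  -- `|u|^α u` is a nonnegative real multiple of `u`, so `ℓ` scales along.
  have key := le_of_integral_bootstrap (d := fun t x ↦ ℓ (u t x)) (T := T)
    (C := lam * M ^ α + 1) (A := ‖ℓ‖ * M) (D := 0) (by positivity) (by positivity) le_rfl ?_ ?_
  · intro t ht x
    simpa using key t ht x
  · intro t _ x
    refine (le_abs_self _).trans ((ℓ.le_opNorm _).trans ?_)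
    gcongr
    exact hu.bound t x
  · intro B hB h t ht x
    have hI := hu.cont_integrand_sub hα t x
    have h1 : ℓ (∫ σ in (0 : ℝ)..t, heatSemigroup (t - σ) (fun y ↦ powNl α (u σ y)) x)
        ≤ M ^ α * ∫ σ in (0 : ℝ)..t, B * Real.exp (2 * (lam * M ^ α + 1) * σ) := by
      rw [← ContinuousLinearMap.intervalIntegral_comp_comm ℓ (hI.intervalIntegrable _ _),
        ← intervalIntegral.integral_const_mul]
      refine intervalIntegral.integral_mono_on ht.1
        ((ℓ.continuous.comp hI).intervalIntegrable _ _)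
        (Continuous.intervalIntegrable (by fun_prop) _ _) fun σ hσ ↦ ?_
      refine apply_heatSemigroup_le ℓ _ (hu.cont_powNl_space hα σ)
        (hu.bound_powNl hα σ) (fun y ↦ ?_) x
      change ℓ (((‖u σ y‖ ^ α : ℝ) : ℂ) * u σ y) ≤ _
      rw [← Complex.real_smul, ℓ.map_smul, smul_eq_mul]
      calc ‖u σ y‖ ^ α * ℓ (u σ y)
          ≤ ‖u σ y‖ ^ α * (B * Real.exp (2 * (lam * M ^ α + 1) * σ)) := by
            gcongr
            exact h σ ⟨hσ.1, hσ.2.trans ht.2⟩ y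
        _ ≤ _ := by
            gcongr
            exact hu.bound σ y
    have h2 : ℓ (heatSemigroup t φ x) ≤ 0 := apply_heatSemigroup_le ℓ t hφ hA hℓ x
    have h3 : 0 ≤ ∫ σ in (0 : ℝ)..t, B * Real.exp (2 * (lam * M ^ α + 1) * σ) :=
      intervalIntegral.integral_nonneg ht.1 fun σ _ ↦ by positivity
    rw [hu.duhamel t ht, map_add, ← Complex.real_smul, ℓ.map_smul, smul_eq_mul]
    refine add_le_add h2 ((mul_le_mul_of_nonneg_left h1 hlam).trans ?_)
    rw [← mul_assoc]
    gcongr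
    linarith

/-- The half-planes `Im ≤ 0`, `Im ≥ 0` and `Re ≥ 0` are each invariant, and they meet in the
nonnegative half-line. -/
theorem eq_ofReal_norm (hα : 0 < α) (hlam : 0 ≤ lam) (hu : IsMild α (lam : ℂ) φ T M u)
    (hφ : Continuous φ) {A : ℝ} (hA : ∀ x, ‖φ x‖ ≤ A) (hφr : ∀ x, φ x = (‖φ x‖ : ℂ)) :
    ∀ t ∈ Icc 0 T, ∀ x, u t x = (‖u t x‖ : ℂ) := by
  intro t ht x
  have him : ∀ y, (φ y).im = 0 := fun y ↦ by rw [hφr y, Complex.ofReal_im]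
  have hre : ∀ y, 0 ≤ (φ y).re := fun y ↦ by rw [hφr y, Complex.ofReal_re]; exact norm_nonneg _
  have h1 := hu.apply_nonpos hα hlam hφ hA Complex.imCLM (fun y ↦ (him y).le) t ht x
  have h2 := hu.apply_nonpos hα hlam hφ hA (-Complex.imCLM) (fun y ↦ by simp [him y]) t ht x
  have h3 := hu.apply_nonpos hα hlam hφ hA (-Complex.reCLM) (fun y ↦ by simp [hre y]) t ht x
  simp only [Complex.imCLM_apply, _root_.neg_apply, Complex.reCLM_apply,
    Left.neg_nonpos_iff] at h1 h2 h3
  have h4 : (u t x).im = 0 := le_antisymm h1 h2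
  have h5 : u t x = ((u t x).re : ℂ) := by
    apply Complex.ext <;> simp [h4]
  rw [h5, Complex.norm_real, Real.norm_of_nonneg h3]

end IsMild

/-- Jensen's inequality for the heat kernel and the power `1 + α`. -/
theorem rpow_le_heatSemigroup_powNl (hα : 0 < α) (t : ℝ) {f : Space N → ℂ} (hf : Continuous f)
    {M : ℝ} (hM : ∀ y, ‖f y‖ ≤ M) (hfr : ∀ y, f y = (‖f y‖ : ℂ)) (x : Space N)
    (hpos : 0 < (heatSemigroup t f x).re) :
    (heatSemigroup t f x).re ^ (1 + α) ≤ (heatSemigroup t (fun y ↦ powNl α (f y)) x).re := by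
  set m := (heatSemigroup t f x).re with hm
  have hi : Integrable fun z : Space N ↦ (heatKernel 1 z : ℂ) * f (x - √t • z) :=
    integrable_heatKernel_mul one_pos (by fun_prop) fun y ↦ hM _
  have hi' : Integrable fun z : Space N ↦ (heatKernel 1 z : ℂ) * powNl α (f (x - √t • z)) :=
    integrable_heatKernel_mul one_pos ((continuous_powNl hα).comp (by fun_prop))
      fun y ↦ norm_powNl_le hα (hM _)
  have hm' : m = ∫ z : Space N, heatKernel 1 z * ‖f (x - √t • z)‖ := by
    rw [hm, heatSemigroup_eq]
    refine (integral_re hi).symm.trans ?_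
    congr 1
    ext z
    simp only [RCLike.re_to_complex]
    rw [hfr, ← Complex.ofReal_mul, Complex.ofReal_re]
    simp
  have hir : Integrable fun z : Space N ↦ heatKernel 1 z * ‖f (x - √t • z)‖ := by
    refine hi.norm.congr (.of_forall fun z ↦ ?_)
    simp only [norm_mul, Complex.norm_real, Real.norm_of_nonneg (heatKernel_pos one_pos z).le]
  -- The tangent line to `r^(1+α)` at the mean `m`, obtained from Bernoulli's inequality; averaging
  -- it gives Jensen.
  have key : ∀ r : ℝ, 0 ≤ r → -(α * m ^ (1 + α)) + (1 + α) * m ^ α * r ≤ r ^ α * r := by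
    intro r hr
    have h1 := one_add_mul_self_le_rpow_one_add (s := r / m - 1) (p := 1 + α)
      (by have : 0 ≤ r / m := by positivity
          linarith) (by linarith)
    rw [add_sub_cancel, Real.div_rpow hr hpos.le, le_div_iff₀ (by positivity)] at h1
    have h2 : r ^ α * r = r ^ (1 + α) := by
      rw [add_comm, Real.rpow_add_one' hr (by positivity)]
    have h3 : m ^ (1 + α) = m * m ^ α := by
      rw [Real.rpow_add hpos, Real.rpow_one]
    rw [h2]
    refine le_trans (le_of_eq ?_) h1
    rw [h3]
    field_simp
    ring
  rw [heatSemigroup_eq]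
  have h5 : (∫ z : Space N, (heatKernel 1 z : ℂ) * powNl α (f (x - √t • z))).re
      = ∫ z : Space N, heatKernel 1 z * (‖f (x - √t • z)‖ ^ α * ‖f (x - √t • z)‖) := by
    refine (integral_re hi').symm.trans ?_
    congr 1
    ext z
    simp only [RCLike.re_to_complex, powNl]
    conv_lhs => rw [hfr (x - √t • z)]
    rw [← Complex.ofReal_mul, ← Complex.ofReal_mul, Complex.ofReal_re]
    simp
  have hir' : Integrable fun z : Space N ↦
      heatKernel 1 z * (‖f (x - √t • z)‖ ^ α * ‖f (x - √t • z)‖) := by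
    refine hi'.norm.congr (.of_forall fun z ↦ ?_)
    simp only [norm_mul, Complex.norm_real, Real.norm_of_nonneg (heatKernel_pos one_pos z).le,
      powNl]
    rw [Real.norm_of_nonneg (by positivity)]
  rw [h5]
  calc m ^ (1 + α) = -(α * m ^ (1 + α)) * 1 + (1 + α) * m ^ α * m := by
        rw [Real.rpow_add hpos, Real.rpow_one]; ring
    _ = ∫ z : Space N, heatKernel 1 z * (-(α * m ^ (1 + α)))
        + (1 + α) * m ^ α * (heatKernel 1 z * ‖f (x - √t • z)‖) := by
        rw [integral_add ((integrable_heatKernel one_pos).mul_const _) (hir.const_mul _),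
          integral_mul_const, integral_const_mul, integral_heatKernel one_pos, ← hm']
        ring
    _ ≤ _ := by
        refine integral_mono (((integrable_heatKernel one_pos).mul_const _).add
          (hir.const_mul _)) hir' fun z ↦ ?_
        have := mul_le_mul_of_nonneg_left (key _ (norm_nonneg (f (x - √t • z))))
          (heatKernel_pos one_pos z).le
        simp only
        linarith

end NLHeat

/-! ### Blow-up of concentrated data below the critical exponent -/

namespace NLHeat

variable {N : ℕ} {α : ℝ}

open FourierTransform

theorem heatSemigroup_intervalIntegral (r : ℝ) {G : ℝ → Space N → ℂ}
    (hG : Continuous fun p : ℝ × Space N ↦ G p.1 p.2) {M : ℝ} (hM : ∀ σ x, ‖G σ x‖ ≤ M)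
    {t : ℝ} (ht : 0 ≤ t) (x : Space N) :
    heatSemigroup r (fun y ↦ ∫ σ in (0 : ℝ)..t, G σ y) x
      = ∫ σ in (0 : ℝ)..t, heatSemigroup r (G σ) x := by
  simp only [heatSemigroup_eq]
  have hG' : Continuous fun p : ℝ × Space N ↦ G p.1 (x - √r • p.2) :=
    hG.comp (f := fun p : ℝ × Space N ↦ (p.1, x - √r • p.2)) (by fun_prop)
  have h := integral_intervalIntegral_mul_swap (μ := volume)
    (G := fun σ z ↦ G σ (x - √r • z)) hG' (fun σ y ↦ hM _ _)
    ((integrable_heatKernel (N := N) one_pos).ofReal (𝕜 := ℂ)) ht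
  simp only [mul_comm] at h ⊢
  exact h

/-- A positive solution of the integral inequality `J(t) ≥ J(0) + lam ∫₀ᵗ J^{1+α}` blows up. -/
theorem mul_rpow_le_one_of_integral_inequality (hα : 0 < α) {lam J₀ T : ℝ} (hlam : 0 < lam)
    (hJ₀ : 0 < J₀) (hT : 0 ≤ T) {q : ℝ → ℝ} (hq : Continuous q)
    (h : ∀ t ∈ Icc 0 T, 0 < J₀ + lam * ∫ σ in (0 : ℝ)..t, q σ →
      (J₀ + lam * ∫ σ in (0 : ℝ)..t, q σ) ^ (1 + α) ≤ q t)
    (hq0 : ∀ t ∈ Icc 0 T, 0 ≤ q t) : α * lam * T * J₀ ^ α ≤ 1 := by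
  set I : ℝ → ℝ := fun t ↦ J₀ + lam * ∫ σ in (0 : ℝ)..t, q σ with hI
  have hI' : ∀ t, HasDerivAt I (lam * q t) t := fun t ↦
    ((intervalIntegral.integral_hasDerivAt_right (hq.intervalIntegrable _ _)
      (hq.stronglyMeasurableAtFilter _ _) hq.continuousAt).const_mul lam).const_add J₀
  have hIpos : ∀ t ∈ Icc 0 T, 0 < I t := by
    intro t ht
    have : 0 ≤ ∫ σ in (0 : ℝ)..t, q σ :=
      intervalIntegral.integral_nonneg ht.1 fun σ hσ ↦ hq0 σ ⟨hσ.1, hσ.2.trans ht.2⟩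
    simp only [hI]
    positivity
  -- From `I' = lam q ≥ lam I^(1+α)` the function `I^(-α) + α lam t` is nonincreasing; positivity of
  -- `I T ^ (-α)` then bounds `T`.
  have hW : ∀ t ∈ Icc 0 T, HasDerivAt (fun t ↦ I t ^ (-α) + α * lam * t)
      (lam * q t * (-α) * I t ^ (-α - 1) + α * lam) t := by
    intro t ht
    refine ((hI' t).rpow_const (Or.inl (hIpos t ht).ne')).add ?_
    simpa using (hasDerivAt_id t).const_mul (α * lam)
  have hanti : AntitoneOn (fun t ↦ I t ^ (-α) + α * lam * t) (Icc 0 T) := by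
    refine antitoneOn_of_deriv_nonpos (convex_Icc 0 T)
      (fun t ht ↦ (hW t ht).continuousAt.continuousWithinAt)
      (fun t ht ↦ (hW t (interior_subset ht)).differentiableAt.differentiableWithinAt)
      fun t ht ↦ ?_
    have ht := interior_subset ht
    rw [(hW t ht).deriv]
    have h1 := h t ht (hIpos t ht)
    have hp := hIpos t ht
    have h2 : I t ^ (1 + α) * I t ^ (-α - 1) = 1 := by
      rw [← Real.rpow_add hp]
      ring_nf
      simp
    have h3 : 1 ≤ q t * I t ^ (-α - 1) :=
      h2.symm.le.trans (mul_le_mul_of_nonneg_right h1 (by positivity))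
    have h4 : 0 ≤ α * lam := by positivity
    nlinarith
  have h1 := hanti (left_mem_Icc.2 hT) (right_mem_Icc.2 hT) hT
  have h2 : I 0 = J₀ := by simp [hI]
  simp only [h2, mul_zero, add_zero] at h1
  have h3 : 0 < I T ^ (-α) := Real.rpow_pos_of_pos (hIpos T ⟨hT, le_rfl⟩) _
  have h4 : α * lam * T ≤ J₀ ^ (-α) := by linarith
  calc α * lam * T * J₀ ^ α ≤ J₀ ^ (-α) * J₀ ^ α := by gcongr
    _ = 1 := by rw [← Real.rpow_add hJ₀]; simp

/-- A necessary condition for the existence of a nonnegative solution on `[0, T]`. -/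
theorem IsMild.mul_rpow_heatSemigroup_le_one {T M lam : ℝ} {φ : Space N → ℂ}
    {u : ℝ → Space N → ℂ} (hα : 0 < α) (hlam : 0 < lam) (hT : 0 ≤ T)
    (hu : IsMild α (lam : ℂ) φ T M u) (hφ : Continuous φ) {A : ℝ} (hA : ∀ x, ‖φ x‖ ≤ A)
    (hφr : ∀ x, φ x = (‖φ x‖ : ℂ)) (hpos : 0 < (heatSemigroup T φ 0).re) :
    α * lam * T * (heatSemigroup T φ 0).re ^ α ≤ 1 := by
  have hur := hu.eq_ofReal_norm hα hlam.le hφ hA hφr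
  have hQ : Continuous fun σ ↦ heatSemigroup (T - σ) (fun y ↦ powNl α (u σ y)) 0 :=
    hu.cont_integrand_sub hα T 0
  -- Applying `e^{(T-t)Δ}` to Duhamel's formula freezes the linear part at `e^{TΔ}φ(0)`, leaving an
  -- integral to which Jensen applies.
  have hJ : ∀ t ∈ Icc 0 T, heatSemigroup (T - t) (u t) 0 = heatSemigroup T φ 0
      + lam * ∫ σ in (0 : ℝ)..t, heatSemigroup (T - σ) (fun y ↦ powNl α (u σ y)) 0 := by
    intro t ht
    have hc : Continuous fun p : ℝ × Space N ↦
        heatSemigroup (t - p.1) (fun y ↦ powNl α (u p.1 y)) p.2 :=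
      (hu.cont_integrand hα).comp (f := fun p : ℝ × Space N ↦ (t - p.1, p.1, p.2)) (by fun_prop)
    have hb : ∀ σ x, ‖heatSemigroup (t - σ) (fun y ↦ powNl α (u σ y)) x‖ ≤ M ^ α * M :=
      fun σ x ↦ norm_heatSemigroup_le _ (hu.bound_powNl hα σ) x
    have hct : Continuous (heatSemigroup t φ : Space N → ℂ) :=
      continuous_heatSemigroup (F := fun _ ↦ φ) (hφ.comp continuous_snd) (fun _ ↦ hA)
        continuous_const continuous_id
    have h1 : heatSemigroup (T - t) (fun y ↦ u t y - heatSemigroup t φ y) 0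
        = lam * ∫ σ in (0 : ℝ)..t, heatSemigroup (T - σ) (fun y ↦ powNl α (u σ y)) 0 := by
      have h2 : (fun y ↦ u t y - heatSemigroup t φ y)
          = fun y ↦ ∫ σ in (0 : ℝ)..t,
            (lam : ℂ) * heatSemigroup (t - σ) (fun y ↦ powNl α (u σ y)) y := by
        ext y
        rw [hu.duhamel t ht, intervalIntegral.integral_const_mul]
        ring
      rw [h2, heatSemigroup_intervalIntegral (M := lam * (M ^ α * M)) _
        (continuous_const.mul hc) _ ht.1, ← intervalIntegral.integral_const_mul]
      · refine intervalIntegral.integral_congr fun σ hσ ↦ ?_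
        rw [uIcc_of_le ht.1] at hσ
        have h3 : heatSemigroup (T - t) (fun y ↦ (lam : ℂ) *
            heatSemigroup (t - σ) (fun y ↦ powNl α (u σ y)) y) 0
            = lam * heatSemigroup (T - t) (fun y ↦
              heatSemigroup (t - σ) (fun y ↦ powNl α (u σ y)) y) 0 := by
          simp only [heatSemigroup_eq (T - t), mul_left_comm _ (lam : ℂ), integral_const_mul]
        rw [h3, heatSemigroup_heatSemigroup (sub_nonneg.2 ht.2) (sub_nonneg.2 hσ.2)
          (hu.cont_powNl_space hα σ) (hu.bound_powNl hα σ)]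
        simp
      · intro σ x
        rw [norm_mul, Complex.norm_real, Real.norm_of_nonneg hlam.le]
        exact mul_le_mul_of_nonneg_left (hb σ x) hlam.le
    rw [heatSemigroup_sub _ (hu.cont_space t) hct (hu.bound t)
      (fun x ↦ norm_heatSemigroup_le t hA x),
      heatSemigroup_heatSemigroup (sub_nonneg.2 ht.2) ht.1 hφ hA, sub_add_cancel] at h1
    rw [← h1]
    ring
  have hJr : ∀ t ∈ Icc 0 T, (heatSemigroup (T - t) (u t) 0).re = (heatSemigroup T φ 0).re
      + lam * ∫ σ in (0 : ℝ)..t, (heatSemigroup (T - σ) (fun y ↦ powNl α (u σ y)) 0).re := by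
    intro t ht
    rw [hJ t ht, Complex.add_re, Complex.re_ofReal_mul]
    congr 2
    exact (ContinuousLinearMap.intervalIntegral_comp_comm Complex.reCLM
      (hQ.intervalIntegrable _ _)).symm
  refine mul_rpow_le_one_of_integral_inequality hα hlam hpos hT
    (q := fun σ ↦ (heatSemigroup (T - σ) (fun y ↦ powNl α (u σ y)) 0).re)
    (Complex.continuous_re.comp hQ) ?_ ?_
  · intro t ht h0
    rw [← hJr t ht] at h0 ⊢
    exact rpow_le_heatSemigroup_powNl hα _ (hu.cont_space t) (hu.bound t) (hur t ht) 0 h0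
  · intro t ht
    have := apply_heatSemigroup_le (-Complex.reCLM) (T - t)
      (hu.cont_powNl_space hα t) (hu.bound_powNl hα t) (c := 0)
      (fun y ↦ ?_) 0
    · simpa using this
    · simp only [_root_.neg_apply, Complex.reCLM_apply,
        Left.neg_nonpos_iff, powNl]
      rw [hur t ht y, Complex.norm_real, norm_norm, ← Complex.ofReal_mul, Complex.ofReal_re]
      positivity

theorem fourier_comp_smul {μ : ℝ} (hμ : 0 < μ) (f : Space N → ℂ) (ξ : Space N) :
    𝓕 (fun x : Space N ↦ f (μ • x)) ξ = ((μ ^ N)⁻¹ : ℝ) * 𝓕 f (μ⁻¹ • ξ) := by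
  rw [Real.fourier_eq, Real.fourier_eq]
  have h := Measure.integral_comp_smul (volume : Measure (Space N))
    (fun x ↦ Real.fourierChar (-inner ℝ x (μ⁻¹ • ξ)) • f x) μ
  rw [finrank_euclideanSpace_fin, abs_of_pos (by positivity), Complex.real_smul] at h
  rw [← h]
  congr 1
  ext x
  rw [inner_smul_left, inner_smul_right]
  simp [hμ.ne']

/-- The `H^s` norm of concentrated functions. -/
theorem hsEnergy_le_of_eq_smul {s : ℝ} (hs : 0 ≤ s) (b h : 𝓢(Space N, ℂ)) {c μ : ℝ} (hμ : 1 ≤ μ)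
    (hh : ∀ x, h x = c * b (μ • x)) :
    hsEnergy s h ≤ c ^ 2 * μ ^ (2 * s - N) * hsEnergy s b := by
  have hμ0 : 0 < μ := one_pos.trans_le hμ
  have hF : ∀ ξ, 𝓕 h ξ = c * (((μ ^ N)⁻¹ : ℝ) * 𝓕 b (μ⁻¹ • ξ)) := by
    intro ξ
    have h4 (c : ℂ) (g : Space N → ℂ) : 𝓕 (c • g) ξ = c • 𝓕 g ξ :=
      congrFun (VectorFourier.fourierIntegral_const_smul _ _ _ _ _) ξ
    have h5 : (h : Space N → ℂ) = (c : ℂ) • fun x ↦ b (μ • x) := by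
      ext x
      simp [hh]
    rw [SchwartzMap.fourier_coe, h5, h4, fourier_comp_smul hμ0, smul_eq_mul,
      SchwartzMap.fourier_coe]
  have h6 := Measure.integral_comp_inv_smul (volume : Measure (Space N))
    (fun η ↦ (1 + ‖μ • η‖ ^ 2) ^ s * (c ^ 2 * ((μ ^ N)⁻¹ ^ 2 * ‖𝓕 b η‖ ^ 2))) μ
  rw [finrank_euclideanSpace_fin, abs_of_pos (by positivity), smul_eq_mul] at h6
  have h7 : hsEnergy s h = μ ^ N * ∫ η, (1 + ‖μ • η‖ ^ 2) ^ s
      * (c ^ 2 * ((μ ^ N)⁻¹ ^ 2 * ‖𝓕 b η‖ ^ 2)) := by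
    rw [← h6, hsEnergy]
    congr 1
    ext ξ
    rw [hF, smul_inv_smul₀ hμ0.ne', norm_mul, norm_mul, Complex.norm_real, Complex.norm_real,
      mul_pow, mul_pow, Real.norm_eq_abs, sq_abs, Real.norm_of_nonneg (by positivity)]
  rw [h7]
  have h8 : ∀ η : Space N, (1 + ‖μ • η‖ ^ 2) ^ s * (c ^ 2 * ((μ ^ N)⁻¹ ^ 2 * ‖𝓕 b η‖ ^ 2))
      ≤ (c ^ 2 * (μ ^ N)⁻¹ ^ 2 * μ ^ (2 * s)) * ((1 + ‖η‖ ^ 2) ^ s * ‖𝓕 b η‖ ^ 2) := by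
    intro η
    -- For `μ ≥ 1` one has `1 + μ²|η|² ≤ μ²(1 + |η|²)`, and `s ≥ 0` preserves the inequality.
    have h9 : (1 + ‖μ • η‖ ^ 2) ^ s ≤ μ ^ (2 * s) * (1 + ‖η‖ ^ 2) ^ s := by
      rw [Real.rpow_mul hμ0.le, Real.rpow_two, ← Real.mul_rpow (by positivity) (by positivity)]
      refine Real.rpow_le_rpow (by positivity) ?_ hs
      rw [norm_smul, Real.norm_of_nonneg hμ0.le, mul_pow]
      nlinarith [sq_nonneg ‖η‖]
    calc _ ≤ (μ ^ (2 * s) * (1 + ‖η‖ ^ 2) ^ s) * (c ^ 2 * ((μ ^ N)⁻¹ ^ 2 * ‖𝓕 b η‖ ^ 2)) := by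
          gcongr
      _ = _ := by ring
  have h10 : ∫ η, (1 + ‖μ • η‖ ^ 2) ^ s * (c ^ 2 * ((μ ^ N)⁻¹ ^ 2 * ‖𝓕 b η‖ ^ 2))
      ≤ (c ^ 2 * (μ ^ N)⁻¹ ^ 2 * μ ^ (2 * s)) * hsEnergy s b := by
    rw [hsEnergy, ← integral_const_mul]
    exact integral_mono_of_nonneg (.of_forall fun η ↦ by positivity)
      ((integrable_bessel_mul s (𝓕 b)).const_mul _) (.of_forall h8)
  refine (mul_le_mul_of_nonneg_left h10 (by positivity)).trans (le_of_eq ?_)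
  rw [Real.rpow_sub hμ0, Real.rpow_natCast]
  field_simp

/-- A continuous function with compact support, as an element of `C₀`. -/
def toC0 (f : Space N → ℂ) (hf : Continuous f) (hc : HasCompactSupport f) : C₀(Space N, ℂ) :=
  ⟨⟨f, hf⟩, hc.is_zero_at_infty⟩

/-- The scaling `μ^(2/α) B(μ x)` preserves the equation and divides the lifespan by `μ²`, while it
shrinks the `H^s` norm below the critical exponent. -/
theorem not_locallyWellPosed_of_lt (hα : 0 < α) {lam s : ℝ} (hlam : 0 < lam) (hs : 0 ≤ s)
    (hsN : s < N / 2 - 2 / α) : ¬ LocallyWellPosedSmallData N s α (lam : ℂ) := by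
  rintro ⟨δ, T, hδ, hT, H⟩
  obtain ⟨b⟩ : Nonempty (ContDiffBump (0 : Space N)) := inferInstance
  set B : Space N → ℂ := fun x ↦ (b x : ℂ) with hB
  have hBd : ContDiff ℝ ∞ B := Complex.ofRealCLM.contDiff.comp b.contDiff
  have hBc : HasCompactSupport B := b.hasCompactSupport.comp_left (g := Complex.ofReal) rfl
  set κ : ℝ := ∫ z : Space N, heatKernel 1 z * b (-z) with hκ
  have hκpos : 0 < κ := by
    refine Continuous.integral_pos_of_hasCompactSupport_nonneg_nonzero (x := 0)
      ((continuous_heatKernel 1).mul (b.continuous.comp continuous_neg)) ?_ ?_ ?_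
    · refine HasCompactSupport.mul_left ?_
      exact b.hasCompactSupport.comp_homeomorph (Homeomorph.neg _)
    · exact fun z ↦ mul_nonneg (heatKernel_pos one_pos z).le b.nonneg
    · have : (b : Space N → ℝ) 0 = 1 := b.one_of_mem_closedBall (by
        simp [Metric.mem_closedBall, b.rIn_pos.le])
      simp only [neg_zero, this, mul_one]
      exact (heatKernel_pos one_pos _).ne'
  -- At time `μ⁻²` the necessary condition reads `α lam (A κ)^α ≤ 1` for every `μ`; `A` is chosen to
  -- violate it.
  obtain ⟨A, hA0, hA⟩ : ∃ A : ℝ, 0 < A ∧ 1 < α * lam * (A * κ) ^ α := by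
    have h1 : Filter.Tendsto (fun A : ℝ ↦ α * lam * (A * κ) ^ α) Filter.atTop Filter.atTop :=
      ((tendsto_rpow_atTop hα).comp (Filter.tendsto_id.atTop_mul_const hκpos)).const_mul_atTop
        (by positivity)
    exact ((Filter.eventually_gt_atTop 0).and (h1.eventually_gt_atTop 1)).exists
  set Bs : 𝓢(Space N, ℂ) := hBc.toSchwartzMap hBd with hBs
  set E := hsEnergy s Bs with hE
  -- The squared norm is at most `A² E μ^(4/α + 2s - N)`, and this exponent is negative exactly when
  -- `s < N/2 - 2/α`. The second condition says `μ⁻² < T`.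
  obtain ⟨μ, hμ1, hμT, hμδ⟩ : ∃ μ : ℝ, 1 ≤ μ ∧ 1 < T * μ ^ 2 ∧
      A ^ 2 * E * μ ^ (4 / α + 2 * s - N) ≤ δ ^ 2 := by
    have h1 : Filter.Tendsto (fun μ : ℝ ↦ T * μ ^ 2) Filter.atTop Filter.atTop :=
      (Filter.tendsto_pow_atTop two_ne_zero).const_mul_atTop hT
    have h2 : Filter.Tendsto (fun μ : ℝ ↦ A ^ 2 * E * μ ^ (-(N - 2 * s - 4 / α))) Filter.atTop
        (nhds (A ^ 2 * E * 0)) :=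
      (tendsto_rpow_neg_atTop (by
        have : 4 / α = 2 * (2 / α) := by ring
        rw [this]; linarith)).const_mul _
    rw [mul_zero] at h2
    obtain ⟨μ, ⟨h3, h4⟩, h5⟩ := (((Filter.eventually_ge_atTop 1).and
      (h1.eventually_gt_atTop 1)).and (h2.eventually_lt_const (by positivity : 0 < δ ^ 2))).exists
    refine ⟨μ, h3, h4, le_trans (le_of_eq ?_) h5.le⟩
    congr 2
    ring
  have hμ0 : 0 < μ := one_pos.trans_le hμ1
  set c : ℝ := A * μ ^ (2 / α) with hc
  have hc0 : 0 < c := by positivity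
  set f : Space N → ℂ := fun x ↦ c * B (μ • x) with hf
  have hfd : ContDiff ℝ ∞ f := contDiff_const.mul (hBd.comp (contDiff_const_smul μ))
  have hfc : HasCompactSupport f := by
    refine HasCompactSupport.mul_left ?_
    exact hBc.comp_homeomorph (Homeomorph.smulOfNeZero μ hμ0.ne')
  set φ := toC0 f hfd.continuous hfc with hφ
  have hφf : ∀ x, φ x = f x := fun x ↦ rfl
  have hnorm : hsNorm s φ ≤ ENNReal.ofReal δ := by
    refine (hsNorm_le (hfc.toSchwartzMap hfd) (fun x ↦ rfl)).trans (ENNReal.ofReal_le_ofReal ?_)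
    rw [Real.sqrt_le_left hδ.le]
    refine (hsEnergy_le_of_eq_smul (c := c) hs Bs _ hμ1 (fun x ↦ rfl)).trans ?_
    refine le_trans (le_of_eq ?_) hμδ
    rw [hc, mul_pow, ← Real.rpow_natCast (μ ^ (2 / α)), ← Real.rpow_mul hμ0.le,
      show (4 / α + 2 * s - N) = 2 / α * (2 : ℕ) + (2 * s - N) by push_cast; ring,
      Real.rpow_add hμ0]
    ring
  obtain ⟨hTmax, -⟩ := H φ hfd hfc hnorm
  have hT₀ : ENNReal.ofReal ((μ ^ 2)⁻¹) < maximalTime α (lam : ℂ) φ := by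
    refine lt_of_lt_of_le ?_ hTmax
    rw [ENNReal.ofReal_lt_ofReal_iff hT, inv_lt_iff_one_lt_mul₀ (by positivity)]
    exact hμT
  obtain ⟨T', ⟨u, hu⟩, hT'⟩ := lt_sSup_iff.1 hT₀
  obtain ⟨M, hM⟩ := hu.exists_isMild (by positivity) hT'
  have hfn : ∀ x, ‖f x‖ = c * b (μ • x) := by
    intro x
    simp only [hf, hB]
    rw [norm_mul, Complex.norm_real, Complex.norm_real, Real.norm_of_nonneg hc0.le,
      Real.norm_of_nonneg b.nonneg]
  have hheat : (heatSemigroup ((μ ^ 2)⁻¹) φ 0).re = c * κ := by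
    have h1 : heatSemigroup ((μ ^ 2)⁻¹) φ 0 = ((c * κ : ℝ) : ℂ) := by
      rw [heatSemigroup_eq, hκ, ← integral_const_mul, ← integral_complex_ofReal]
      congr 1
      ext z
      rw [hφf]
      simp only [hf, hB]
      rw [Real.sqrt_inv, Real.sqrt_sq hμ0.le, zero_sub, smul_neg, smul_smul,
        mul_inv_cancel₀ hμ0.ne', one_smul]
      push_cast
      ring
    rw [h1, Complex.ofReal_re]
  have hle := hM.mul_rpow_heatSemigroup_le_one hα hlam (by positivity) hfd.continuous
    (A := c) (fun x ↦ ?_) (fun x ↦ ?_) (by rw [hheat]; positivity)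
  · rw [hheat, hc] at hle
    have h1 : (A * μ ^ (2 / α) * κ) ^ α = μ ^ 2 * (A * κ) ^ α := by
      rw [show A * μ ^ (2 / α) * κ = μ ^ (2 / α) * (A * κ) by ring,
        Real.mul_rpow (by positivity) (by positivity), ← Real.rpow_mul hμ0.le,
        div_mul_cancel₀ _ hα.ne', Real.rpow_two]
    rw [h1] at hle
    have h2 : α * lam * (μ ^ 2)⁻¹ * (μ ^ 2 * (A * κ) ^ α) = α * lam * (A * κ) ^ α := by
      field_simp
    linarith
  · rw [hφf, hfn]
    exact mul_le_of_le_one_right hc0.le b.le_one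
  · rw [hφf, hfn]
    simp only [hf, hB]
    push_cast
    rfl

end NLHeat

/-! ### Maximal solutions, Lipschitz bounds and odd data -/

namespace NLHeat

variable {N : ℕ} {α : ℝ}

open FourierTransform Laplacian

theorem norm_apply_le_norm (f : C₀(Space N, ℂ)) (x : Space N) : ‖f x‖ ≤ ‖f‖ := by
  rw [← ZeroAtInftyContinuousMap.norm_toBCF_eq_norm]
  exact f.toBCF.norm_coe_le_norm x

theorem IsSolutionOn.eq_of_lt (hα : 0 < α) (hα2 : α < 2) {lam : ℂ} {φ : C₀(Space N, ℂ)}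
    {T T' : ℝ≥0∞} {u v : ℝ → C₀(Space N, ℂ)} (hu : IsSolutionOn α lam φ T u)
    (hv : IsSolutionOn α lam φ T' v) {t : ℝ} (ht : 0 ≤ t) (h : ENNReal.ofReal t < T)
    (h' : ENNReal.ofReal t < T') : u t = v t := by
  obtain ⟨M, hM⟩ := hu.exists_isMild ht h
  obtain ⟨M', hM'⟩ := hv.exists_isMild ht h'
  ext x
  have h1 := (hM.mono le_rfl (le_max_left M M')).norm_sub_le hα hα2
    (hM'.mono le_rfl (le_max_right M M')) φ.continuous φ.continuous
    (norm_apply_le_norm φ) (norm_apply_le_norm φ) (D := 0) (by simp) t ⟨ht, le_rfl⟩ x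
  simp only [min_self, max_eq_right ht, mul_zero, zero_mul] at h1
  exact sub_eq_zero.1 (norm_le_zero_iff.1 h1)

/-- Solutions on shorter intervals can be glued to a maximal one. -/
theorem exists_isSolutionOn_maximalTime (hα : 0 < α) (hα2 : α < 2) (lam : ℂ)
    (φ : C₀(Space N, ℂ)) : ∃ u, IsSolutionOn α lam φ (maximalTime α lam φ) u := by
  have hex : ∀ t : ℝ, ∃ (T : ℝ≥0∞) (v : ℝ → C₀(Space N, ℂ)),
      ENNReal.ofReal t < maximalTime α lam φ → ENNReal.ofReal t < T ∧ IsSolutionOn α lam φ T v := by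
    intro t
    by_cases ht : ENNReal.ofReal t < maximalTime α lam φ
    · obtain ⟨T', ⟨v, hv⟩, hT'⟩ := lt_sSup_iff.1 ht
      exact ⟨T', v, fun _ ↦ ⟨hT', hv⟩⟩
    · exact ⟨0, 0, fun h ↦ absurd h ht⟩
  choose τ v hτv using hex
  -- By uniqueness the chosen solutions agree wherever both live, so the diagonal `v t t` locally
  -- coincides with one of them.
  have heq : ∀ t σ : ℝ, ENNReal.ofReal t < maximalTime α lam φ → 0 ≤ σ →
      ENNReal.ofReal σ < maximalTime α lam φ → ENNReal.ofReal σ < τ t → v σ σ = v t σ :=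
    fun t σ ht h0 hσ hσt ↦
      (hτv σ hσ).2.eq_of_lt hα hα2 (hτv t ht).2 h0 (hτv σ hσ).1 hσt
  refine ⟨fun t ↦ v t t, ?_, ?_⟩
  · rintro t ⟨ht0, ht⟩
    have hopen : {σ : ℝ | ENNReal.ofReal σ < τ t} ∈ nhds t :=
      (isOpen_lt ENNReal.continuous_ofReal continuous_const).mem_nhds (hτv t ht).1
    have hc := (hτv t ht).2.continuousOn t ⟨ht0, (hτv t ht).1⟩
    refine (hc.mono_of_mem_nhdsWithin ?_).congr_of_eventuallyEq ?_ rfl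
    · filter_upwards [mem_nhdsWithin_of_mem_nhds hopen, self_mem_nhdsWithin] with σ h1 h2
      exact ⟨h2.1, h1⟩
    · filter_upwards [mem_nhdsWithin_of_mem_nhds hopen, self_mem_nhdsWithin] with σ h1 h2
      exact heq t σ ht h2.1 h2.2 h1
  · intro t ht0 ht x
    rw [(hτv t ht).2.duhamel t ht0 (hτv t ht).1]
    congr 2
    refine intervalIntegral.integral_congr fun σ hσ ↦ ?_
    rw [uIcc_of_le ht0] at hσ
    have h1 := ENNReal.ofReal_le_ofReal hσ.2
    rw [heq t σ ht hσ.1 (h1.trans_lt ht) (h1.trans_lt (hτv t ht).1)]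

theorem exists_lipschitz_schwartz (g : 𝓢(Space N, ℂ)) :
    ∃ L : ℝ, 0 ≤ L ∧ ∀ x k, ‖g (x + k) - g x‖ ≤ L * ‖k‖ := by
  set g' := SchwartzMap.fderivCLM ℝ (Space N) ℂ g
  refine ⟨‖g'.toBoundedContinuousFunction‖, norm_nonneg _, fun x k ↦ ?_⟩
  have h := (convex_univ (𝕜 := ℝ) (E := Space N)).norm_image_sub_le_of_norm_fderiv_le (f := g)
    (x := x) (y := x + k)
    (fun y _ ↦ (g.hasFDerivAt y).differentiableAt)
    (fun y _ ↦ g'.toBoundedContinuousFunction.norm_coe_le_norm y) (mem_univ _) (mem_univ _)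
  simpa using h

/-- The deviation of a solution from smooth data is Lipschitz with a constant `O(t)`. -/
theorem IsMild.exists_lipschitz_sub {lam : ℂ} {T M : ℝ} {u : ℝ → Space N → ℂ} (hα : 0 < α)
    (hα2 : α < 2) (Φ : 𝓢(Space N, ℂ)) (hu : IsMild α lam Φ T M u) :
    ∃ K : ℝ, 0 ≤ K ∧ ∀ t ∈ Icc 0 T, ∀ x k,
      ‖(u t (x + k) - Φ (x + k)) - (u t x - Φ x)‖ ≤ K * t * ‖k‖ := by
  obtain ⟨L, hL, hΦ⟩ := exists_lipschitz_schwartz Φ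
  obtain ⟨L', hL', hΔ⟩ := exists_lipschitz_schwartz (Δ Φ : 𝓢(Space N, ℂ))
  have hM := hu.nonneg
  have hbd (g : 𝓢(Space N, ℂ)) (x : Space N) : ‖g x‖ ≤ ‖g.toBoundedContinuousFunction‖ :=
    g.toBoundedContinuousFunction.norm_coe_le_norm x
  set γ : ℝ := 2 * (‖lam‖ * (3 * M ^ α) + 1) with hγ
  have hγ0 : 0 ≤ γ := by positivity
  refine ⟨L' + ‖lam‖ * (3 * M ^ α) * (2 * L * Real.exp (γ * T)), by positivity, ?_⟩
  intro t ht x k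
  have h1 : ∀ σ ∈ Icc 0 t, ∀ y, ‖u σ (y + k) - u σ y‖ ≤ 2 * (L * ‖k‖) * Real.exp (γ * T) := by
    intro σ hσ y
    -- The translate solves the equation with translated data, which differ by at most `L ‖k‖`.
    have := (hu.comp_add k).norm_sub_le hα hα2 hu
      (Φ.continuous.comp (continuous_id.add continuous_const)) Φ.continuous
      (fun x ↦ hbd Φ (x + k)) (hbd Φ) (D := L * ‖k‖) (fun x ↦ hΦ x k) σ
      ⟨hσ.1, hσ.2.trans ht.2⟩ y
    refine this.trans ?_
    have h2 : γ * σ ≤ γ * T := by gcongr; exact hσ.2.trans ht.2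
    gcongr
  have h2 := IsMild.norm_duhamel_sub_le hα hα2 (hu.comp_add k) hu ht.1 x continuous_const h1
  rw [intervalIntegral.integral_const, smul_eq_mul, sub_zero] at h2
  have hc : Continuous fun p : ℝ × Space N ↦ heatSemigroup p.1 (Δ Φ : 𝓢(Space N, ℂ)) p.2 :=
    continuous_heatSemigroup (X := ℝ × Space N) (F := fun _ ↦ (Δ Φ : 𝓢(Space N, ℂ)))
      ((Δ Φ : 𝓢(Space N, ℂ)).continuous.comp continuous_snd) (fun _ ↦ hbd _)
      continuous_fst continuous_snd
  -- The linear deviation is `∫₀ᵗ e^{rΔ} ΔΦ dr`; its integrand is Lipschitz in space uniformly in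
  -- `r`, whence the factor `t`.
  have h3 : ‖(heatSemigroup t Φ (x + k) - Φ (x + k)) - (heatSemigroup t Φ x - Φ x)‖
      ≤ L' * ‖k‖ * t := by
    rw [heatSemigroup_sub_self Φ ht.1, heatSemigroup_sub_self Φ ht.1,
      ← intervalIntegral.integral_sub]
    · refine (intervalIntegral.norm_integral_le_of_norm_le_const (C := L' * ‖k‖)
        fun r _ ↦ ?_).trans (by rw [sub_zero, abs_of_nonneg ht.1])
      rw [← heatSemigroup_comp_add, ← heatSemigroup_sub _
        (f := fun y ↦ (Δ Φ : 𝓢(Space N, ℂ)) (y + k))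
        ((Δ Φ : 𝓢(Space N, ℂ)).continuous.comp (continuous_id.add continuous_const))
        (Δ Φ : 𝓢(Space N, ℂ)).continuous (fun y ↦ hbd _ (y + k)) (hbd _)]
      exact norm_heatSemigroup_le r (fun y ↦ hΔ y k) x
    · exact (hc.comp (f := fun r : ℝ ↦ (r, x + k)) (by fun_prop)).intervalIntegrable _ _
    · exact (hc.comp (f := fun r : ℝ ↦ (r, x)) (by fun_prop)).intervalIntegrable _ _
  have h4 := (hu.comp_add k).duhamel t ht x
  rw [heatSemigroup_comp_add] at h4
  rw [h4, hu.duhamel t ht x]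
  set I₁ := ∫ σ in (0 : ℝ)..t, heatSemigroup (t - σ) (fun y ↦ powNl α (u σ (y + k))) x
  set I₂ := ∫ σ in (0 : ℝ)..t, heatSemigroup (t - σ) (fun y ↦ powNl α (u σ y)) x
  calc _ = ‖((heatSemigroup t Φ (x + k) - Φ (x + k)) - (heatSemigroup t Φ x - Φ x))
        + (lam * I₁ - lam * I₂)‖ := by congr 1; ring
    _ ≤ _ := norm_add_le _ _
    _ ≤ _ := add_le_add h3 h2
    _ = _ := by ring

/-- The reflection in a coordinate hyperplane. -/
noncomputable def reflectCoord (i : Fin N) : Space N ≃ₗᵢ[ℝ] Space N :=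
  LinearIsometryEquiv.piLpCongrRight 2 fun j ↦
    if j = i then LinearIsometryEquiv.neg ℝ else LinearIsometryEquiv.refl ℝ ℝ

theorem reflectCoord_apply (i j : Fin N) (x : Space N) :
    reflectCoord i x j = if j = i then -x j else x j := by
  simp only [reflectCoord, LinearIsometryEquiv.piLpCongrRight_apply]
  split_ifs <;> simp

/-- Both `u t` and `Φ` vanish on the hyperplane `xᵢ = 0`: the reflected solution and `-u` have the
same data, hence agree. The Lipschitz bound from the orthogonal projection `x₀` to `x` gives the
factor `|xᵢ|`. -/
theorem IsMild.norm_sub_le_of_odd {lam : ℂ} {T M : ℝ} {u : ℝ → Space N → ℂ} (hα : 0 < α)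
    (hα2 : α < 2) (i : Fin N) (Φ : 𝓢(Space N, ℂ)) (hu : IsMild α lam Φ T M u)
    (hodd : ∀ x, Φ (reflectCoord i x) = -Φ x) :
    ∃ K : ℝ, 0 ≤ K ∧ ∀ t ∈ Icc 0 T, ∀ x, ‖u t x - Φ x‖ ≤ K * t * |x i| := by
  obtain ⟨K, hK, h⟩ := hu.exists_lipschitz_sub hα hα2 Φ
  refine ⟨K, hK, fun t ht x ↦ ?_⟩
  have hbd (x : Space N) : ‖Φ x‖ ≤ ‖Φ.toBoundedContinuousFunction‖ :=
    Φ.toBoundedContinuousFunction.norm_coe_le_norm x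
  set e : Space N := EuclideanSpace.single i (1 : ℝ) with he
  set x₀ := x - x i • e with hx₀
  have hfix : reflectCoord i x₀ = x₀ := by
    ext j
    rw [reflectCoord_apply]
    split_ifs with hj
    · subst hj
      simp [hx₀, he]
    · rfl
  have hΦ0 : Φ x₀ = 0 := by
    have := hodd x₀
    rw [hfix] at this
    exact self_eq_neg.1 this
  have hu0 : u t x₀ = 0 := by
    have h1 := (hu.comp_isometry (reflectCoord i)).norm_sub_le hα hα2 hu.neg
      (Φ.continuous.comp (reflectCoord i).continuous) Φ.continuous.neg
      (fun x ↦ hbd _) (fun x ↦ by rw [norm_neg]; exact hbd x) (D := 0)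
      (fun x ↦ by simp [hodd]) t ht x₀
    simp only [hfix, mul_zero, zero_mul] at h1
    exact self_eq_neg.1 (sub_eq_zero.1 (norm_le_zero_iff.1 h1))
  have h2 := h t ht x₀ (x i • e)
  rw [hΦ0, hu0, hx₀, sub_add_cancel, sub_zero, sub_zero, norm_smul, Real.norm_eq_abs, he,
    PiLp.norm_single, norm_one, mul_one] at h2
  exact h2

end NLHeat

/-! ### Finite differences, negative Sobolev norms and stretching -/

namespace NLHeat

variable {N : ℕ} {α : ℝ}

open FourierTransform Laplacian

/-- The backward difference of a Schwartz function. -/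
noncomputable def schwartzDiff (k : Space N) (h : 𝓢(Space N, ℂ)) : 𝓢(Space N, ℂ) :=
  h.compSubConstCLM ℂ k - h

theorem integral_mul_schwartzDiff (k : Space N) (h : 𝓢(Space N, ℂ)) {f : Space N → ℂ}
    (hf : Continuous f) {M : ℝ} (hM : ∀ x, ‖f x‖ ≤ M) :
    ∫ x, f x * schwartzDiff k h x = ∫ x, (f (x + k) - f x) * h x := by
  have hi : Integrable h := h.integrable
  have h1 : Integrable fun x ↦ f x * h x :=
    hi.bdd_mul hf.aestronglyMeasurable (.of_forall hM)
  have h2 : Integrable fun x ↦ f x * h (x - k) :=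
    (hi.comp_sub_right k).bdd_mul hf.aestronglyMeasurable (.of_forall hM)
  have h3 : Integrable fun x ↦ f (x + k) * h x :=
    hi.bdd_mul (c := M) (by fun_prop) (.of_forall fun x ↦ hM _)
  have h4 : ∀ x, schwartzDiff k h x = h (x - k) - h x := fun x ↦ rfl
  simp only [h4, mul_sub, sub_mul]
  rw [integral_sub h2 h1, integral_sub h3 h1,
    ← integral_add_right_eq_self (fun x ↦ f x * h (x - k)) k]
  simp only [add_sub_cancel_right]

theorem integral_mul_schwartzDiff_iterate_four (k : Space N) (h : 𝓢(Space N, ℂ))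
    {f : Space N → ℂ} (hf : Continuous f) {M : ℝ} (hM : ∀ x, ‖f x‖ ≤ M) :
    ∫ x, f x * (schwartzDiff k)^[4] h x
      = ∫ x, (f (x + (4 : ℝ) • k) - 4 * f (x + (3 : ℝ) • k) + 6 * f (x + (2 : ℝ) • k)
        - 4 * f (x + k) + f x) * h x := by
  have hb : ∀ {g : Space N → ℂ} {M : ℝ}, (∀ x, ‖g x‖ ≤ M) →
      ∀ x, ‖g (x + k) - g x‖ ≤ M + M := fun hg x ↦
    (norm_sub_le _ _).trans (add_le_add (hg _) (hg _))
  simp only [Function.iterate_succ, Function.iterate_zero, Function.comp_apply, id]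
  rw [integral_mul_schwartzDiff k _ hf hM]
  rw [integral_mul_schwartzDiff k _ (f := fun x ↦ f (x + k) - f x) (by fun_prop) (hb hM)]
  rw [integral_mul_schwartzDiff k _ (f := fun x ↦ f (x + k + k) - f (x + k) - (f (x + k) - f x))
    (by fun_prop) (hb (hb hM))]
  rw [integral_mul_schwartzDiff k _ (f := fun x ↦ f (x + k + k + k) - f (x + k + k)
    - (f (x + k + k) - f (x + k)) - (f (x + k + k) - f (x + k) - (f (x + k) - f x)))
    (by fun_prop) (hb (hb (hb hM)))]
  congr 1
  ext x
  have e2 : x + (2 : ℝ) • k = x + k + k := by module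
  have e3 : x + (3 : ℝ) • k = x + k + k + k := by module
  have e4 : x + (4 : ℝ) • k = x + k + k + k + k := by module
  rw [e2, e3, e4]
  ring

theorem fourier_schwartzDiff (k : Space N) (h : 𝓢(Space N, ℂ)) (ξ : Space N) :
    𝓕 (schwartzDiff k h) ξ
      = (Complex.exp (Complex.I * (-(2 * Real.pi * inner ℝ k ξ) : ℝ)) - 1) * 𝓕 h ξ := by
  have h1 : 𝓕 (schwartzDiff k h) = 𝓕 (h.compSubConstCLM ℂ k) - 𝓕 h :=
    map_sub (fourierCLM ℂ 𝓢(Space N, ℂ)) _ _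
  have h2 : 𝓕 (h.compSubConstCLM ℂ k) ξ
      = Complex.exp (Complex.I * (-(2 * Real.pi * inner ℝ k ξ) : ℝ)) * 𝓕 h ξ := by
    rw [SchwartzMap.fourier_coe, SchwartzMap.fourier_coe, Real.fourier_eq', Real.fourier_eq',
      ← integral_const_mul, ← integral_add_right_eq_self _ k]
    congr 1
    ext x
    rw [SchwartzMap.compSubConstCLM_apply, add_sub_cancel_right, smul_eq_mul, smul_eq_mul,
      ← mul_assoc, ← Complex.exp_add, inner_add_left]
    congr 2
    push_cast
    ring
  rw [h1, _root_.sub_apply, h2, sub_mul, one_mul]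

theorem fourier_schwartzDiff_iterate (n : ℕ) (k : Space N) (h : 𝓢(Space N, ℂ)) (ξ : Space N) :
    𝓕 ((schwartzDiff k)^[n] h) ξ
      = (Complex.exp (Complex.I * (-(2 * Real.pi * inner ℝ k ξ) : ℝ)) - 1) ^ n * 𝓕 h ξ := by
  induction n with
  | zero => simp
  | succ n ih =>
    rw [Function.iterate_succ_apply', fourier_schwartzDiff, ih, pow_succ]
    ring

/-- One of the eight factors is bounded by `2` instead of `|θ|`. The exponent `7` leaves room for
the four powers of frequency from the squared Laplacian within `2s ≥ 11`. -/
theorem norm_exp_sub_one_pow_eight_le (θ : ℝ) :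
    (‖Complex.exp (Complex.I * θ) - 1‖ ^ 4) ^ 2 ≤ 2 * |θ| ^ 7 := by
  have h1 : ‖Complex.exp (Complex.I * θ) - 1‖ ≤ |θ| :=
    Real.norm_exp_I_mul_ofReal_sub_one_le
  have h2 : ‖Complex.exp (Complex.I * θ) - 1‖ ≤ 2 := by
    refine (norm_sub_le _ _).trans ?_
    rw [mul_comm, Complex.norm_exp_ofReal_mul_I, norm_one]
    norm_num
  calc _ = ‖Complex.exp (Complex.I * θ) - 1‖ * ‖Complex.exp (Complex.I * θ) - 1‖ ^ 7 := by ring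
    _ ≤ 2 * |θ| ^ 7 := by gcongr

theorem pow_mul_bessel_le_one {s : ℝ} {m : ℕ} (hm : (m : ℝ) ≤ 2 * s) {r : ℝ} (hr : 0 ≤ r) :
    (1 + r ^ 2) ^ (-s) * r ^ m ≤ 1 := by
  have h1 : r ^ m ≤ (1 + r ^ 2) ^ ((m : ℝ) / 2) := by
    calc r ^ m = (r ^ 2) ^ ((m : ℝ) / 2) := by
          rw [← Real.rpow_natCast, ← Real.rpow_two, ← Real.rpow_mul hr]
          congr 1
          ring
      _ ≤ _ := by
          gcongr
          linarith
  calc (1 + r ^ 2) ^ (-s) * r ^ m ≤ (1 + r ^ 2) ^ (-s) * (1 + r ^ 2) ^ ((m : ℝ) / 2) := by gcongr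
    _ = (1 + r ^ 2) ^ (-s + (m : ℝ) / 2) := by rw [← Real.rpow_add (by positivity)]
    _ ≤ 1 := Real.rpow_le_one_of_one_le_of_nonpos (by nlinarith [sq_nonneg r]) (by linarith)

/-- The weight `(1 + |ξ|²)^(-s)` absorbs `|ξ|^m` as long as `m ≤ 2s`; Plancherel handles the rest.
-/
theorem hsEnergy_neg_le_of_norm_fourier_le {s : ℝ} {m : ℕ} (hm : (m : ℝ) ≤ 2 * s) {C : ℝ}
    (hC : 0 ≤ C) (g h : 𝓢(Space N, ℂ)) (H : ∀ ξ, ‖𝓕 g ξ‖ ^ 2 ≤ C * ‖ξ‖ ^ m * ‖𝓕 h ξ‖ ^ 2) :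
    hsEnergy (-s) g ≤ C * ∫ x, ‖h x‖ ^ 2 := by
  rw [← SchwartzMap.integral_norm_sq_fourier, hsEnergy, ← integral_const_mul]
  have hi : Integrable fun ξ ↦ ‖𝓕 h ξ‖ ^ 2 := by
    simpa using integrable_bessel_mul 0 (𝓕 h)
  refine integral_mono_of_nonneg (.of_forall fun ξ ↦ by positivity) (hi.const_mul C)
    (.of_forall fun ξ ↦ ?_)
  simp only
  calc (1 + ‖ξ‖ ^ 2) ^ (-s) * ‖𝓕 g ξ‖ ^ 2
      ≤ (1 + ‖ξ‖ ^ 2) ^ (-s) * (C * ‖ξ‖ ^ m * ‖𝓕 h ξ‖ ^ 2) := by gcongr; exact H ξ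
    _ = ((1 + ‖ξ‖ ^ 2) ^ (-s) * ‖ξ‖ ^ m) * (C * ‖𝓕 h ξ‖ ^ 2) := by ring
    _ ≤ 1 * (C * ‖𝓕 h ξ‖ ^ 2) := by
        gcongr
        exact pow_mul_bessel_le_one hm (norm_nonneg ξ)
    _ = _ := one_mul _

theorem norm_sq_fourier_schwartzDiff_le (k : Space N) (h : 𝓢(Space N, ℂ)) (ξ : Space N) :
    ‖𝓕 ((schwartzDiff k)^[4] h) ξ‖ ^ 2
      ≤ 2 * (2 * Real.pi * ‖k‖) ^ 7 * ‖ξ‖ ^ 7 * ‖𝓕 h ξ‖ ^ 2 := by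
  have hpi := Real.pi_pos
  rw [fourier_schwartzDiff_iterate, norm_mul, mul_pow, norm_pow]
  have h1 := norm_exp_sub_one_pow_eight_le (-(2 * Real.pi * inner ℝ k ξ))
  have h2 : |-(2 * Real.pi * inner ℝ k ξ)| ≤ 2 * Real.pi * (‖k‖ * ‖ξ‖) := by
    rw [abs_neg, abs_mul, abs_of_pos (by positivity)]
    gcongr
    exact abs_real_inner_le_norm k ξ
  refine mul_le_mul_of_nonneg_right ?_ (by positivity)
  calc _ ≤ _ := h1
    _ ≤ 2 * (2 * Real.pi * (‖k‖ * ‖ξ‖)) ^ 7 := by gcongr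
    _ = _ := by ring

theorem hsEnergy_schwartzDiff_le {s : ℝ} (hs : 11 / 2 ≤ s) (k : Space N) (h : 𝓢(Space N, ℂ)) :
    hsEnergy (-s) ((schwartzDiff k)^[4] h)
      ≤ 2 * (2 * Real.pi * ‖k‖) ^ 7 * ∫ x, ‖h x‖ ^ 2 := by
  have hpi := Real.pi_pos
  exact hsEnergy_neg_le_of_norm_fourier_le (m := 7) (by push_cast; linarith) (by positivity) _ _
    (norm_sq_fourier_schwartzDiff_le k h)

/-- The squared symbol of `Δ` adds `|ξ|^4` to the `|ξ|^7` of the differences. The requirement `11 ≤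
2s` is the source of the `11` in the dimension condition. -/
theorem hsEnergy_laplacian_schwartzDiff_le {s : ℝ} (hs : 11 / 2 ≤ s) (k : Space N)
    (h : 𝓢(Space N, ℂ)) :
    hsEnergy (-s) (Δ ((schwartzDiff k)^[4] h) : 𝓢(Space N, ℂ))
      ≤ (2 * Real.pi) ^ 4 * (2 * (2 * Real.pi * ‖k‖) ^ 7) * ∫ x, ‖h x‖ ^ 2 := by
  have hpi := Real.pi_pos
  refine hsEnergy_neg_le_of_norm_fourier_le (m := 11) (by push_cast; linarith) (by positivity) _ _
    fun ξ ↦ ?_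
  rw [fourier_laplacian, norm_mul, norm_neg, Complex.norm_real, Real.norm_of_nonneg (by positivity),
    mul_pow]
  calc _ ≤ ((2 * Real.pi) ^ 2 * ‖ξ‖ ^ 2) ^ 2 *
        (2 * (2 * Real.pi * ‖k‖) ^ 7 * ‖ξ‖ ^ 7 * ‖𝓕 h ξ‖ ^ 2) := by
        gcongr
        exact norm_sq_fourier_schwartzDiff_le k h ξ
    _ = _ := by ring

/-- Multiplication of one coordinate by a constant. -/
noncomputable def stretch (i : Fin N) (c : ℝ) : Space N →ₗ[ℝ] Space N :=
  Matrix.toEuclideanLin (Matrix.diagonal (Function.update 1 i c))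

theorem stretch_apply (i j : Fin N) (c : ℝ) (x : Space N) :
    stretch i c x j = Function.update (1 : Fin N → ℝ) i c j * x j := by
  simp [stretch, Matrix.toLpLin_apply, Matrix.mulVec_diagonal]

theorem stretch_eq (i : Fin N) (c : ℝ) (x : Space N) :
    stretch i c x = x + ((c - 1) * x i) • EuclideanSpace.single i (1 : ℝ) := by
  ext j
  rw [stretch_apply]
  by_cases hj : j = i
  · subst hj
    simp
    ring
  · simp [hj]

theorem stretch_stretch_inv (i : Fin N) {c : ℝ} (hc : c ≠ 0) (x : Space N) :
    stretch i c (stretch i c⁻¹ x) = x := by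
  ext j
  rw [stretch_apply, stretch_apply]
  by_cases hj : j = i
  · subst hj
    simp [hc]
  · simp [hj]

theorem det_stretch (i : Fin N) (c : ℝ) : LinearMap.det (stretch i c) = c := by
  rw [stretch, Matrix.toEuclideanLin, Matrix.toLpLin_eq_toLin, LinearMap.det_toLin,
    Matrix.det_diagonal,
    Finset.prod_update_of_mem (Finset.mem_univ i)]
  simp

/-- The stretching map as an equivalence. -/
noncomputable def stretchEquiv (i : Fin N) {c : ℝ} (hc : c ≠ 0) : Space N ≃L[ℝ] Space N :=
  LinearEquiv.toContinuousLinearEquiv <| LinearEquiv.ofLinearMap (stretch i c) (stretch i c⁻¹)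
    (LinearMap.ext fun x ↦ stretch_stretch_inv i hc x)
    (LinearMap.ext fun x ↦ by
      have := stretch_stretch_inv i (inv_ne_zero hc) x
      rwa [inv_inv] at this)

theorem integral_comp_stretch {E : Type*} [NormedAddCommGroup E] [NormedSpace ℝ E] (i : Fin N)
    {c : ℝ} (hc : 0 < c) (f : Space N → E) : ∫ x, f x = c • ∫ y, f (stretch i c y) := by
  have h1 := Measure.map_linearMap_addHaar_eq_smul_addHaar (μ := (volume : Measure (Space N)))
    (f := stretch i c) (by rw [det_stretch]; exact hc.ne')
  rw [det_stretch, abs_of_pos (by positivity)] at h1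
  have h2 := (stretchEquiv i hc.ne').toHomeomorph.measurableEmbedding.integral_map
    (μ := (volume : Measure (Space N))) f
  have h3 : ((stretchEquiv i hc.ne').toHomeomorph : Space N → Space N) = stretch i c := rfl
  rw [h3, h1, integral_smul_measure, ENNReal.toReal_ofReal (by positivity)] at h2
  rw [← h2, smul_inv_smul₀ hc.ne']

/-- Strict concavity of `x^(α/2)` at `4 = (3/8)·9 + (5/8)·1`. After division by `4^(α/2)` it becomes
two Bernoulli inequalities, at `5/4` and `-3/4`; equality would hold at `α = 0` and `α = 2`. -/
theorem three_mul_rpow_lt (hα : 0 < α) (hα2 : α < 2) :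
    3 * (3 : ℝ) ^ α + 5 < 8 * 2 ^ α := by
  have h1 := rpow_one_add_lt_one_add_mul_self (s := 5 / 4) (p := α / 2) (by norm_num) (by norm_num)
    (by linarith) (by linarith)
  have h2 := rpow_one_add_lt_one_add_mul_self (s := -3 / 4) (p := α / 2) (by norm_num)
    (by norm_num) (by linarith) (by linarith)
  have h3 : (1 + 5 / 4 : ℝ) ^ (α / 2) = 3 ^ α / 2 ^ α := by
    rw [← Real.div_rpow (by norm_num) (by norm_num),
      show (1 + 5 / 4 : ℝ) = (3 / 2) ^ (2 : ℝ) by norm_num, ← Real.rpow_mul (by norm_num)]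
    congr 1
    ring
  have h4 : (1 + -3 / 4 : ℝ) ^ (α / 2) = 1 / 2 ^ α := by
    rw [show (1 + -3 / 4 : ℝ) = (1 / 2) ^ (2 : ℝ) by norm_num, ← Real.rpow_mul (by norm_num),
      mul_div_cancel₀ _ two_ne_zero, Real.div_rpow (by norm_num) (by norm_num), Real.one_rpow]
  rw [h3] at h1
  rw [h4] at h2
  have h5 : (0 : ℝ) < 2 ^ α := by positivity
  have h6 : 3 * ((3 : ℝ) ^ α / 2 ^ α) + 5 * (1 / 2 ^ α) < 8 := by linarith
  have h7 := mul_lt_mul_of_pos_right h6 h5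
  have h8 : (3 * ((3 : ℝ) ^ α / 2 ^ α) + 5 * (1 / 2 ^ α)) * 2 ^ α = 3 * (3 : ℝ) ^ α + 5 := by
    field_simp
  linarith

end NLHeat

/-! ### Test functions detecting the singularity -/

namespace NLHeat

variable {N : ℕ} {α : ℝ}

open FourierTransform Laplacian

/-- The fourth difference of `|y|^α y` is negative near `-1`. -/
theorem exists_fourth_difference_lt (hα : 0 < α) (hα2 : α < 2) :
    ∃ c r : ℝ, 0 < c ∧ 0 < r ∧ ∀ y, |y + 1| < r →
      |y + 4| ^ α * (y + 4) - 4 * (|y + 3| ^ α * (y + 3)) + 6 * (|y + 2| ^ α * (y + 2))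
        - 4 * (|y + 1| ^ α * (y + 1)) + |y| ^ α * y < -(2 * c) := by
  set g : ℝ → ℝ := fun y ↦ |y + 4| ^ α * (y + 4) - 4 * (|y + 3| ^ α * (y + 3))
    + 6 * (|y + 2| ^ α * (y + 2)) - 4 * (|y + 1| ^ α * (y + 1)) + |y| ^ α * y with hg
  have hcont : Continuous g := by
    have : ∀ a : ℝ, Continuous fun y : ℝ ↦ |y + a| ^ α := fun a ↦
      (by fun_prop : Continuous fun y : ℝ ↦ |y + a|).rpow_const fun _ ↦ Or.inr hα.le
    have h0 : Continuous fun y : ℝ ↦ |y| ^ α :=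
      continuous_abs.rpow_const fun _ ↦ Or.inr hα.le
    have h4 := this 4
    have h3 := this 3
    have h2 := this 2
    have h1 := this 1
    fun_prop
  have h := three_mul_rpow_lt hα hα2
  -- The nodes are `3, 2, 1, 0, -1`: they straddle the singularity, and the value is negative by
  -- `three_mul_rpow_lt`.
  have hval : g (-1) = 3 * (3 : ℝ) ^ α + 5 - 8 * 2 ^ α := by
    simp only [hg]
    norm_num
    ring
  have hneg : g (-1) < -(2 * ((8 * 2 ^ α - (3 * (3 : ℝ) ^ α + 5)) / 4)) := by
    rw [hval]
    linarith
  obtain ⟨r, hr, hball⟩ := Metric.eventually_nhds_iff.1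
    (hcont.continuousAt.eventually_lt_const hneg)
  refine ⟨(8 * 2 ^ α - (3 * (3 : ℝ) ^ α + 5)) / 4, r, by linarith, hr, fun y hy ↦ hball ?_⟩
  rwa [Real.dist_eq, sub_neg_eq_add]

theorem norm_stretch_sub_add_le (i : Fin N) {ε : ℝ} (hε : 0 < ε) (hε' : ε ≤ 1 / 12)
    {y : Space N} (hy : ‖y + EuclideanSpace.single i (1 : ℝ)‖ ≤ 1 / 4) {j : ℝ}
    (hj : 0 ≤ j) (hj' : j ≤ 4) :
    ‖stretch i ε y + j • ε • EuclideanSpace.single i (1 : ℝ)‖ ≤ 1 := by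
  set e : Space N := EuclideanSpace.single i (1 : ℝ) with he
  have hne : ‖e‖ = 1 := by simp [he]
  set z := y + e with hz
  have hzi : z i = y i + 1 := by simp [hz, he]
  have h1 : stretch i ε y + j • ε • e = z + ((ε - 1) * z i) • e + (ε * (j - 1)) • e := by
    rw [stretch_eq, hzi, hz]
    module
  have h2 : |z i| ≤ ‖z‖ := by
    simpa using PiLp.norm_apply_le z i
  have h3 : ‖((ε - 1) * z i) • e‖ ≤ 1 / 4 := by
    rw [norm_smul, hne, mul_one, Real.norm_eq_abs, abs_mul]
    have : |ε - 1| ≤ 1 := by rw [abs_le]; constructor <;> linarith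
    calc |ε - 1| * |z i| ≤ 1 * (1 / 4) := by gcongr; exact h2.trans hy
      _ = 1 / 4 := one_mul _
  have h4 : ‖(ε * (j - 1)) • e‖ ≤ 1 / 4 := by
    rw [norm_smul, hne, mul_one, Real.norm_eq_abs, abs_mul, abs_of_pos hε]
    have : |j - 1| ≤ 3 := by rw [abs_le]; constructor <;> linarith
    calc ε * |j - 1| ≤ 1 / 12 * 3 := by gcongr
      _ = 1 / 4 := by norm_num
  rw [h1]
  calc _ ≤ ‖z‖ + ‖((ε - 1) * z i) • e‖ + ‖(ε * (j - 1)) • e‖ := norm_add₃_le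
    _ ≤ 1 := by linarith

/-- Test functions concentrated near a hyperplane, which are small in negative Sobolev norms
but detect the limited smoothness of `|x i|^α x i`. -/
theorem exists_testFunctions (i : Fin N) (hα : 0 < α) (hα2 : α < 2) :
    ∃ (h : ℝ → 𝓢(Space N, ℂ)) (c C η : ℝ), 0 < c ∧ 0 ≤ C ∧ 0 < η ∧ ∀ ε, 0 < ε → ε ≤ 1 / 12 →
      (∀ s, 11 / 2 ≤ s → √(hsEnergy (-s) (h ε)) ≤ C * ε ^ 4 ∧
        √(hsEnergy (-s) (Δ (h ε) : 𝓢(Space N, ℂ))) ≤ C * ε ^ 4) ∧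
      ∀ f : Space N → ℂ, Continuous f → ∀ M, (∀ x, ‖f x‖ ≤ M) → ∀ A, 0 ≤ A →
        (∀ x, ‖x‖ ≤ 1 → ‖f x - (A * (|x i| ^ α * x i) : ℝ)‖ ≤ η * (A * (|x i| ^ α * |x i|))) →
        (∫ x, f x * h ε x).re ≤ -(c * A * ε ^ (2 + α)) := by
  obtain ⟨c₀, r, hc₀, hr, hdiff⟩ := exists_fourth_difference_lt hα hα2
  set e : Space N := EuclideanSpace.single i (1 : ℝ) with he
  have hne : ‖e‖ = 1 := by simp [he]
  have hei : e i = 1 := by simp [he]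
  -- The outer radius keeps `yᵢ` where the fourth difference is negative and keeps all shifted,
  -- stretched points in the unit ball.
  set b : ContDiffBump (-e) := ⟨min r (1 / 4) / 2, min r (1 / 4), by positivity,
    half_lt_self (by positivity)⟩ with hb
  set B : Space N → ℂ := fun x ↦ (b x : ℂ) with hB
  have hBd : ContDiff ℝ ∞ B := Complex.ofRealCLM.contDiff.comp b.contDiff
  have hBc : HasCompactSupport B := b.hasCompactSupport.comp_left (g := Complex.ofReal) rfl
  set Bs : 𝓢(Space N, ℂ) := hBc.toSchwartzMap hBd with hBs
  have hBsb : ∀ y, Bs y = (b y : ℂ) := fun y ↦ rfl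
  have hbi : Integrable (b : Space N → ℝ) := b.integrable
  have hbpos : 0 < ∫ y, b y := b.integral_pos
  -- `3456 = 16 · 216`: the binomial coefficients sum to `16` in absolute value, and `216 = 6³`
  -- bounds `|yᵢ + j|^(1+α)`.
  set η : ℝ := c₀ / 3456 with hη
  have hpi := Real.pi_pos
  have h2pi : 1 ≤ 2 * Real.pi := by linarith [Real.pi_gt_three]
  set K : ℝ := (2 * Real.pi) ^ 4 * (2 * (2 * Real.pi) ^ 7) * ∫ x, ‖Bs x‖ ^ 2 with hK
  have hK0 : 0 ≤ K := mul_nonneg (by positivity) (integral_nonneg fun x ↦ by positivity)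
  set Φ : ℝ → 𝓢(Space N, ℂ) := fun ε ↦ if hε : ε ≠ 0 then
    SchwartzMap.compCLMOfContinuousLinearEquiv ℂ (stretchEquiv i (inv_ne_zero hε)) Bs else 0
    with hΦ
  have hΦs : ∀ ε, 0 < ε → ∀ y, Φ ε (stretch i ε y) = b y := by
    intro ε hε y
    simp only [hΦ, dif_pos hε.ne']
    rw [SchwartzMap.compCLMOfContinuousLinearEquiv_apply, Function.comp_apply, hBsb]
    have h1 := stretch_stretch_inv i (inv_ne_zero hε.ne') y
    rw [inv_inv] at h1
    congr 2
  have hΦ2 : ∀ ε, 0 < ε → ∫ x, ‖Φ ε x‖ ^ 2 = ε * ∫ x, ‖Bs x‖ ^ 2 := by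
    intro ε hε
    rw [integral_comp_stretch i hε, smul_eq_mul]
    simp only [hΦs ε hε, hBsb]
  refine ⟨fun ε ↦ (schwartzDiff (ε • e))^[4] (Φ ε), c₀ * ∫ y, b y, √K, η, by positivity,
    Real.sqrt_nonneg _, by positivity, fun ε hε hε' ↦ ⟨fun s hs ↦ ?_, ?_⟩⟩
  · have hk : ‖ε • e‖ = ε := by rw [norm_smul, hne, mul_one, Real.norm_of_nonneg hε.le]
    -- Of the eight powers of `ε` in the energy, seven come from the step of the differences and one
    -- from the volume of the stretched bump.
    have h4 : √K * ε ^ 4 = √(K * ε ^ 8) := by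
      rw [Real.sqrt_mul hK0, show ε ^ 8 = (ε ^ 4) ^ 2 by ring, Real.sqrt_sq (by positivity)]
    have hB0 : 0 ≤ ∫ x, ‖Bs x‖ ^ 2 := integral_nonneg fun x ↦ by positivity
    rw [h4]
    constructor
    · refine Real.sqrt_le_sqrt ((hsEnergy_schwartzDiff_le hs _ _).trans ?_)
      rw [hk, hΦ2 ε hε, hK]
      have h5 : 1 ≤ (2 * Real.pi) ^ 4 := one_le_pow₀ h2pi
      calc _ = 1 * ((2 * (2 * Real.pi) ^ 7 * ∫ x, ‖Bs x‖ ^ 2) * ε ^ 8) := by ring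
        _ ≤ (2 * Real.pi) ^ 4 * ((2 * (2 * Real.pi) ^ 7 * ∫ x, ‖Bs x‖ ^ 2) * ε ^ 8) := by
          gcongr
        _ = _ := by ring
    · refine Real.sqrt_le_sqrt ((hsEnergy_laplacian_schwartzDiff_le hs _ _).trans ?_)
      rw [hk, hΦ2 ε hε, hK]
      refine le_of_eq ?_
      ring
  · intro f hf M hM A hA hfA
    rw [integral_mul_schwartzDiff_iterate_four _ _ hf hM, integral_comp_stretch i hε]
    simp only [hΦs ε hε]
    set F : Space N → ℂ := fun y ↦ f (stretch i ε y + (4 : ℝ) • ε • e)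
      - 4 * f (stretch i ε y + (3 : ℝ) • ε • e) + 6 * f (stretch i ε y + (2 : ℝ) • ε • e)
      - 4 * f (stretch i ε y + ε • e) + f (stretch i ε y) with hF
    have hFc : Continuous F := by
      have : Continuous (stretch i ε) := LinearMap.continuous_of_finiteDimensional _
      fun_prop
    have hFM : ∀ y, ‖F y‖ ≤ M + 4 * M + 6 * M + 4 * M + M := by
      intro y
      simp only [hF]
      refine (norm_add_le _ _).trans (add_le_add ((norm_sub_le _ _).trans (add_le_add
        ((norm_add_le _ _).trans (add_le_add ((norm_sub_le _ _).trans (add_le_add (hM _) ?_)) ?_))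
        ?_)) (hM _))
      all_goals
        rw [norm_mul]
        norm_num
        exact hM _
    have hbC : Integrable fun y ↦ (b y : ℂ) := hbi.ofReal
    have hint : Integrable fun y ↦ F y * (b y : ℂ) :=
      hbC.bdd_mul hFc.aestronglyMeasurable (.of_forall hFM)
    have hre : (ε • ∫ y, F y * (b y : ℂ)).re = ε * ∫ y, (F y).re * b y := by
      rw [Complex.real_smul, Complex.re_ofReal_mul]
      congr 1
      refine (integral_re hint).symm.trans ?_
      congr 1
      ext y
      simp only [RCLike.re_to_complex]
      rw [Complex.re_mul_ofReal]
    have hreint : Integrable fun y ↦ (F y).re * b y := by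
      refine hint.re.congr (.of_forall fun y ↦ ?_)
      simp only [RCLike.re_to_complex]
      rw [Complex.re_mul_ofReal]
    -- The fourth difference contributes less than `-2c₀`; the relative error costs at most `c₀`, so
    -- `-c₀` survives.
    have hpt : ∀ y, (F y).re * b y ≤ -(c₀ * A * (ε ^ α * ε)) * b y := by
      intro y
      by_cases hy : y ∈ Function.support b
      · rw [b.support_eq, Metric.mem_ball, dist_eq_norm, sub_neg_eq_add] at hy
        refine mul_le_mul_of_nonneg_right ?_ b.nonneg
        have hy1 : ‖y + e‖ < r := hy.trans_le (min_le_left _ _)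
        have hy2 : ‖y + e‖ ≤ 1 / 4 := hy.le.trans (min_le_right _ _)
        have hyi : |y i + 1| ≤ ‖y + e‖ := by
          have := PiLp.norm_apply_le (y + e) i
          rwa [PiLp.add_apply, hei, Real.norm_eq_abs] at this
        have hyb := abs_le.1 (hyi.trans hy2)
        have hpt1 : ∀ j : ℝ, 0 ≤ j → j ≤ 4 →
            |(f (stretch i ε y + j • ε • e)).re - A * (ε ^ α * ε) * (|y i + j| ^ α * (y i + j))|
              ≤ η * (A * (ε ^ α * ε)) * 216 := by
          intro j hj hj'
          have h1 := hfA _ (norm_stretch_sub_add_le i hε hε' hy2 hj hj')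
          have hxi : (stretch i ε y + j • ε • e) i = ε * (y i + j) := by
            rw [PiLp.add_apply, stretch_apply]
            simp [he]
            ring
          rw [hxi] at h1
          have h2 : |ε * (y i + j)| ^ α = ε ^ α * |y i + j| ^ α := by
            rw [abs_mul, abs_of_pos hε, Real.mul_rpow hε.le (abs_nonneg _)]
          rw [h2, abs_mul, abs_of_pos hε] at h1
          have h3 : |y i + j| ≤ 6 := by rw [abs_le]; constructor <;> linarith [hyb.1, hyb.2]
          have h4 : |y i + j| ^ α * |y i + j| ≤ 216 := by
            calc |y i + j| ^ α * |y i + j| ≤ 6 ^ α * 6 := by gcongr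
              _ ≤ 6 ^ (2 : ℝ) * 6 := by gcongr; norm_num
              _ = 216 := by norm_num
          have h5 := (Complex.abs_re_le_norm _).trans h1
          rw [Complex.sub_re, Complex.ofReal_re] at h5
          calc _ = |(f (stretch i ε y + j • ε • e)).re
                - A * (ε ^ α * |y i + j| ^ α * (ε * (y i + j)))| := by congr 2; ring
            _ ≤ _ := h5
            _ = η * (A * (ε ^ α * ε)) * (|y i + j| ^ α * |y i + j|) := by ring
            _ ≤ _ := by gcongr
        have hd := hdiff (y i) (hyi.trans_lt hy1)
        have p4 := (abs_le.1 (hpt1 4 (by norm_num) le_rfl)).2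
        have p3 := (abs_le.1 (hpt1 3 (by norm_num) (by norm_num))).1
        have p2 := (abs_le.1 (hpt1 2 (by norm_num) (by norm_num))).2
        have p1 := (abs_le.1 (hpt1 1 (by norm_num) (by norm_num))).1
        have p0 := (abs_le.1 (hpt1 0 le_rfl (by norm_num))).2
        rw [one_smul] at p1
        rw [zero_smul, add_zero, add_zero] at p0
        have hFre : (F y).re = (f (stretch i ε y + (4 : ℝ) • ε • e)).re
            - 4 * (f (stretch i ε y + (3 : ℝ) • ε • e)).re
            + 6 * (f (stretch i ε y + (2 : ℝ) • ε • e)).re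
            - 4 * (f (stretch i ε y + ε • e)).re + (f (stretch i ε y)).re := by
          simp only [hF]
          simp
        set P := A * (ε ^ α * ε) with hP
        have hP0 : 0 ≤ P := by positivity
        have hd2 := mul_le_mul_of_nonneg_left hd.le hP0
        have h16 : 16 * (η * P * 216) = c₀ * P := by rw [hη]; ring
        rw [hFre]
        have hgoal : -(c₀ * A * (ε ^ α * ε)) = -(c₀ * P) := by rw [hP]; ring
        rw [hgoal]
        linarith
      · have : b y = 0 := Function.notMem_support.1 hy
        rw [this, mul_zero, mul_zero]
    have hε2 : ε ^ (2 + α) = ε * (ε ^ α * ε) := by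
      rw [Real.rpow_add hε, Real.rpow_two]
      ring
    change (ε • ∫ y, F y * (b y : ℂ)).re ≤ _
    rw [hre, hε2]
    calc ε * ∫ y, (F y).re * b y ≤ ε * ∫ y, -(c₀ * A * (ε ^ α * ε)) * b y := by
          gcongr
          · exact hbi.const_mul _
          · exact hpt
      _ = _ := by
          rw [integral_const_mul]
          ring

end NLHeat

/-! ### Baire's theorem and the contradiction with `H^s` regularity -/

namespace NLHeat

variable {N : ℕ} {α : ℝ}

open Laplacian

theorem continuous_integral_mul_schwartz {G : ℝ → Space N → ℂ}
    (hG : Continuous fun p : ℝ × Space N ↦ G p.1 p.2) {M : ℝ} (hM : ∀ t x, ‖G t x‖ ≤ M)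
    (h : 𝓢(Space N, ℂ)) : Continuous fun t ↦ ∫ x, G t x * h x := by
  refine continuous_of_dominated (bound := fun x ↦ M * ‖h x‖) (fun t ↦ ?_) (fun t ↦ ?_)
    (h.integrable.norm.const_mul M) (.of_forall fun x ↦ ?_)
  · have : Continuous (G t) := hG.comp (f := fun x : Space N ↦ (t, x)) (by fun_prop)
    exact (this.mul h.continuous).aestronglyMeasurable
  · refine .of_forall fun x ↦ ?_
    rw [norm_mul]
    exact mul_le_mul_of_nonneg_right (hM t x) (norm_nonneg _)
  · exact (hG.comp (f := fun t : ℝ ↦ (t, x)) (by fun_prop)).mul continuous_const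

/-- By Baire's theorem, pointwise-in-time `H^s` bounds are uniform on some time interval. -/
theorem exists_interval_uniform_bound {T s : ℝ} (hT : 0 < T) {u : ℝ → Space N → ℂ}
    (hu : Continuous fun p : ℝ × Space N ↦ u p.1 p.2) {M : ℝ} (hM : ∀ t x, ‖u t x‖ ≤ M)
    (H : ∀ t ∈ Icc 0 T, ∃ B : ℝ, ∀ h : 𝓢(Space N, ℂ), ‖∫ x, u t x * h x‖ ≤ B * √(hsEnergy (-s) h)) :
    ∃ a b B : ℝ, 0 < a ∧ a < b ∧ b < T ∧ 0 ≤ B ∧ ∀ t ∈ Icc a b, ∀ h : 𝓢(Space N, ℂ),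
      ‖∫ x, u t x * h x‖ ≤ B * √(hsEnergy (-s) h) := by
  -- Each set is closed because every pairing with a fixed `h` is continuous in time. Clamping to
  -- `[0, T]` lets the sets cover the whole line.
  set F : ℕ → Set ℝ := fun n ↦ {t | ∀ h : 𝓢(Space N, ℂ),
    ‖∫ x, u (max 0 (min t T)) x * h x‖ ≤ n * √(hsEnergy (-s) h)} with hF
  have hcl : ∀ n, IsClosed (F n) := by
    intro n
    simp only [hF, Set.ofPred_forall]
    refine isClosed_iInter fun h ↦ isClosed_le ?_ continuous_const
    exact ((continuous_integral_mul_schwartz hu hM h).comp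
      (f := fun t : ℝ ↦ max 0 (min t T)) (by fun_prop)).norm
  have hun : ⋃ n, F n = univ := by
    refine eq_univ_of_forall fun t ↦ mem_iUnion.2 ?_
    obtain ⟨B, hB⟩ := H (max 0 (min t T)) ⟨le_max_left _ _, max_le hT.le (min_le_right _ _)⟩
    obtain ⟨n, hn⟩ := exists_nat_ge B
    exact ⟨n, fun h ↦ (hB h).trans (by gcongr)⟩
  obtain ⟨t, ht, ht'⟩ := (dense_iUnion_interior_of_closed hcl hun).inter_open_nonempty (Ioo 0 T)
    isOpen_Ioo (nonempty_Ioo.2 hT)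
  obtain ⟨n, hn⟩ := mem_iUnion.1 ht'
  obtain ⟨r, hr, hball⟩ := Metric.isOpen_iff.1 (isOpen_interior.inter isOpen_Ioo) t ⟨hn, ht⟩
  have hsub : ∀ τ ∈ Icc t (t + r / 2), τ ∈ interior (F n) ∩ Ioo 0 T := by
    intro τ hτ
    refine hball ?_
    rw [Metric.mem_ball, Real.dist_eq, abs_lt]
    constructor <;> linarith [hτ.1, hτ.2]
  refine ⟨t, t + r / 2, n, ht.1, by linarith, (hsub _ ⟨by linarith, le_rfl⟩).2.2,
    n.cast_nonneg, fun τ hτ h ↦ ?_⟩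
  have h1 := interior_subset (hsub τ hτ).1 h
  rwa [min_eq_left (hsub τ hτ).2.2.le, max_eq_right (hsub τ hτ).2.1.le] at h1

/-- A solution whose nonlinearity behaves like `|xᵢ|^α xᵢ` near the origin does not stay in
`H^s`, `s ≥ 11/2`. -/
theorem exists_not_forall_bounded (i : Fin N) (hα : 0 < α) (hα2 : α < 2) :
    ∃ η : ℝ, 0 < η ∧ ∀ {s : ℝ}, 11 / 2 ≤ s → ∀ {lam T M A A' : ℝ} {φ : Space N → ℂ}
      {u : ℝ → Space N → ℂ}, 0 < lam → 0 < T → 0 < A → IsMild α (lam : ℂ) φ T M u →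
      Continuous φ → (∀ x, ‖φ x‖ ≤ A') →
      (∀ t ∈ Icc 0 T, ∀ x : Space N, ‖x‖ ≤ 1 →
        ‖powNl α (u t x) - (A * (|x i| ^ α * x i) : ℝ)‖ ≤ η * (A * (|x i| ^ α * |x i|))) →
      ¬ ∀ t ∈ Icc 0 T, ∃ B : ℝ, ∀ h : 𝓢(Space N, ℂ),
        ‖∫ x, u t x * h x‖ ≤ B * √(hsEnergy (-s) h) := by
  obtain ⟨h, c, C, η, hc, hC, hη, hh⟩ := exists_testFunctions i hα hα2
  refine ⟨η, hη, ?_⟩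
  intro s hs lam T M A A' φ u hlam hT hA hu hφ hA' hnl H
  obtain ⟨a, b, B, ha, hab, hb, hB, hbd⟩ := exists_interval_uniform_bound hT hu.cont hu.bound H
  set D := lam * ((b - a) * (c * A)) with hD
  have hab0 : 0 < b - a := sub_pos.2 hab
  have hD0 : 0 < D := by positivity
  set E := (2 + (b - a)) * (B * C) with hE
  -- Such an `ε` exists because `2 - α > 0`; this is `E ε^4 < D ε^(2+α)` after division by
  -- `ε^(2+α)`.
  obtain ⟨ε, ⟨hε', hε⟩, hεE⟩ : ∃ ε : ℝ, (ε ≤ 1 / 12 ∧ 0 < ε) ∧ E * ε ^ (2 - α) < D := by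
    have h1 : Filter.Tendsto (fun ε : ℝ ↦ E * ε ^ (2 - α)) (nhdsWithin 0 (Ioi 0))
        (nhds (E * 0)) := by
      have := (Real.continuousAt_rpow_const 0 (2 - α) (Or.inr (by linarith))).tendsto
      rw [Real.zero_rpow (by linarith)] at this
      exact (this.mono_left nhdsWithin_le_nhds).const_mul E
    rw [mul_zero] at h1
    have h2 : ∀ᶠ ε : ℝ in nhdsWithin 0 (Ioi 0), ε ≤ 1 / 12 :=
      nhdsWithin_le_nhds (eventually_le_nhds (by norm_num))
    exact ((h2.and self_mem_nhdsWithin).and (h1.eventually_lt_const hD0)).exists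
  obtain ⟨hen, htest⟩ := hh ε hε hε'
  obtain ⟨hen1, hen2⟩ := hen s hs
  have hcΔ := continuous_integral_mul_schwartz hu.cont hu.bound (Δ (h ε))
  have hcP := continuous_integral_mul_schwartz (hu.cont_powNl hα) (hu.bound_powNl hα) (h ε)
  have h1 := hu.weak_form hα hφ hA' (h ε) (t := a) ⟨ha.le, (hab.trans hb).le⟩
  have h2 := hu.weak_form hα hφ hA' (h ε) (t := b) ⟨(ha.trans hab).le, hb.le⟩
  set I := ∫ τ in a..b, ∫ x, powNl α (u τ x) * h ε x with hI
  -- Subtracting the weak forms at `a` and `b` cancels the initial data and leaves only times with a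
  -- uniform `H^s` bound.
  have hIeq : (lam : ℂ) * I = (∫ x, u b x * h ε x) - (∫ x, u a x * h ε x)
      - ∫ τ in a..b, ∫ x, u τ x * (Δ (h ε)) x := by
    rw [hI, ← intervalIntegral.integral_interval_sub_left (hcP.intervalIntegrable 0 b)
      (hcP.intervalIntegrable 0 a), ← intervalIntegral.integral_interval_sub_left
      (hcΔ.intervalIntegrable 0 b) (hcΔ.intervalIntegrable 0 a)]
    linear_combination h1 - h2
  have hup : lam * ‖I‖ ≤ E * ε ^ 4 := by
    have e1 := (hbd b ⟨hab.le, le_rfl⟩ (h ε)).trans (mul_le_mul_of_nonneg_left hen1 hB)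
    have e2 := (hbd a ⟨le_rfl, hab.le⟩ (h ε)).trans (mul_le_mul_of_nonneg_left hen1 hB)
    have e3 : ‖∫ τ in a..b, ∫ x, u τ x * (Δ (h ε)) x‖ ≤ B * (C * ε ^ 4) * |b - a| := by
      refine intervalIntegral.norm_integral_le_of_norm_le_const fun τ hτ ↦ ?_
      rw [uIoc_of_le hab.le] at hτ
      exact (hbd τ ⟨hτ.1.le, hτ.2⟩ (Δ (h ε))).trans (mul_le_mul_of_nonneg_left hen2 hB)
    rw [abs_of_pos hab0] at e3
    calc lam * ‖I‖ = ‖(lam : ℂ) * I‖ := by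
          rw [norm_mul, Complex.norm_real, Real.norm_of_nonneg hlam.le]
      _ ≤ B * (C * ε ^ 4) + B * (C * ε ^ 4) + B * (C * ε ^ 4) * (b - a) := by
          rw [hIeq]
          exact (norm_sub_le _ _).trans (add_le_add ((norm_sub_le _ _).trans (add_le_add e1 e2)) e3)
      _ = E * ε ^ 4 := by rw [hE]; ring
  have hlow : I.re ≤ -((b - a) * (c * A * ε ^ (2 + α))) := by
    have e1 : I.re = ∫ τ in a..b, (∫ x, powNl α (u τ x) * h ε x).re :=
      (ContinuousLinearMap.intervalIntegral_comp_comm Complex.reCLM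
        (hcP.intervalIntegrable _ _)).symm
    rw [e1]
    calc _ ≤ ∫ _ in a..b, -(c * A * ε ^ (2 + α)) := by
          refine intervalIntegral.integral_mono_on hab.le
            ((Complex.continuous_re.comp hcP).intervalIntegrable _ _)
            intervalIntegrable_const fun τ hτ ↦ ?_
          have hτ' : τ ∈ Icc 0 T := ⟨ha.le.trans hτ.1, hτ.2.trans hb.le⟩
          exact htest _ (hu.cont_powNl_space hα τ) _ (hu.bound_powNl hα τ) A hA.le
            (hnl τ hτ')
      _ = _ := by
          rw [intervalIntegral.integral_const, smul_eq_mul]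
          ring
  have e1 : (b - a) * (c * A * ε ^ (2 + α)) ≤ ‖I‖ := by
    have := (abs_le.1 (Complex.abs_re_le_norm I)).1
    linarith
  have e2 : D * ε ^ (2 + α) ≤ E * ε ^ (2 - α) * ε ^ (2 + α) := by
    have e3 : ε ^ (2 - α) * ε ^ (2 + α) = ε ^ 4 := by
      rw [← Real.rpow_add hε, ← Real.rpow_natCast]
      congr 1
      push_cast
      ring
    rw [mul_assoc E, e3]
    refine le_trans (le_of_eq ?_) ((mul_le_mul_of_nonneg_left e1 hlam.le).trans hup)
    rw [hD]
    ring
  have := le_of_mul_le_mul_right e2 (Real.rpow_pos_of_pos hε _)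
  linarith

end NLHeat

/-! ### Odd data, linear near the origin, and the conclusion -/

namespace NLHeat

variable {N : ℕ} {α : ℝ}

/-- A smooth compactly supported function that equals the coordinate `xᵢ` on the unit ball. -/
noncomputable def cutoffCoord (i : Fin N) (x : Space N) : ℂ :=
  ((x i * Real.smoothTransition (2 - ‖x‖ ^ 2) : ℝ) : ℂ)

theorem contDiff_cutoffCoord (i : Fin N) : ContDiff ℝ ∞ (cutoffCoord i) := by
  have h1 : ContDiff ℝ ∞ fun x : Space N ↦ Real.smoothTransition (2 - ‖x‖ ^ 2) :=
    Real.smoothTransition.contDiff.comp (contDiff_const.sub (contDiff_norm_sq ℝ))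
  have h2 : ContDiff ℝ ∞ fun x : Space N ↦ x i := by fun_prop
  exact Complex.ofRealCLM.contDiff.comp (h2.mul h1)

theorem hasCompactSupport_cutoffCoord (i : Fin N) : HasCompactSupport (cutoffCoord i) := by
  refine HasCompactSupport.intro (isCompact_closedBall 0 2) fun x hx ↦ ?_
  rw [mem_closedBall_zero_iff, not_le] at hx
  rw [cutoffCoord, Real.smoothTransition.zero_of_nonpos (by nlinarith), mul_zero,
    Complex.ofReal_zero]

theorem cutoffCoord_of_norm_le_one (i : Fin N) {x : Space N} (hx : ‖x‖ ≤ 1) :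
    cutoffCoord i x = (x i : ℂ) := by
  rw [cutoffCoord, Real.smoothTransition.one_of_one_le, mul_one]
  nlinarith [norm_nonneg x]

theorem cutoffCoord_reflectCoord (i : Fin N) (x : Space N) :
    cutoffCoord i (reflectCoord i x) = -cutoffCoord i x := by
  simp only [cutoffCoord, LinearIsometryEquiv.norm_map, reflectCoord_apply, if_true]
  push_cast
  ring

/-- Both points lie in the disc of radius `2κ|y|`, where the nonlinearity has Lipschitz constant `3
(2κ|y|)^α`; the factor `12` is `3 · 4` with `2^α ≤ 4`. The error remains relative to `|y|^(1+α)`. -/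
theorem norm_powNl_sub_le_of_norm_sub_le (hα : 0 < α) (hα2 : α < 2) {κ η y : ℝ} {z : ℂ}
    (hκ : 0 ≤ κ) (hη : η ≤ 1) (h : ‖z - (κ * y : ℝ)‖ ≤ η * (κ * |y|)) :
    ‖powNl α z - (κ ^ α * κ * (|y| ^ α * y) : ℝ)‖ ≤ 12 * η * (κ ^ α * κ * (|y| ^ α * |y|)) := by
  have hR : 0 ≤ κ * |y| := by positivity
  have hw : ‖((κ * y : ℝ) : ℂ)‖ = κ * |y| := by
    rw [Complex.norm_real, Real.norm_eq_abs, abs_mul, abs_of_nonneg hκ]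
  have hz : ‖z‖ ≤ 2 * (κ * |y|) := by
    calc ‖z‖ = ‖(z - (κ * y : ℝ)) + (κ * y : ℝ)‖ := by rw [sub_add_cancel]
      _ ≤ η * (κ * |y|) + κ * |y| := (norm_add_le _ _).trans (add_le_add h hw.le)
      _ ≤ 1 * (κ * |y|) + κ * |y| := by gcongr
      _ = _ := by ring
  have h1 := norm_powNl_sub_le hα hα2 hz (hw.le.trans (by linarith : _ ≤ 2 * (κ * |y|)))
  have h2 : powNl α ((κ * y : ℝ) : ℂ) = (κ ^ α * κ * (|y| ^ α * y) : ℝ) := by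
    rw [powNl, hw, Real.mul_rpow hκ (abs_nonneg y)]
    push_cast
    ring
  have h3 : (2 : ℝ) ^ α ≤ 4 := by
    calc (2 : ℝ) ^ α ≤ 2 ^ (2 : ℝ) := by gcongr; norm_num
      _ = 4 := by norm_num
  rw [h2] at h1
  calc _ ≤ 3 * (2 * (κ * |y|)) ^ α * (η * (κ * |y|)) := h1.trans (by gcongr)
    _ = 2 ^ α * (3 * (κ * |y|) ^ α * (η * (κ * |y|))) := by
        rw [Real.mul_rpow two_pos.le hR]
        ring
    _ ≤ 4 * (3 * (κ * |y|) ^ α * (η * (κ * |y|))) := by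
        have : 0 ≤ η * (κ * |y|) := (norm_nonneg _).trans h
        gcongr
    _ = _ := by
        rw [Real.mul_rpow hκ (abs_nonneg y)]
        ring

/-- A small multiple of the cut-off coordinate has a solution whose nonlinearity keeps the `|xᵢ|^α
xᵢ` singularity for short times. -/
theorem not_locallyWellPosed_of_ge (i : Fin N) (hα : 0 < α) (hα2 : α < 2) {lam s : ℝ}
    (hlam : 0 < lam) (hs : 11 / 2 ≤ s) : ¬ LocallyWellPosedSmallData N s α (lam : ℂ) := by
  rintro ⟨δ, T, hδ, hT, H⟩
  obtain ⟨η, hη, hηH⟩ := exists_not_forall_bounded i hα hα2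
  set B : 𝓢(Space N, ℂ) :=
    (hasCompactSupport_cutoffCoord i).toSchwartzMap (contDiff_cutoffCoord i)
  set E := hsEnergy s B with hE
  have hE0 : 0 ≤ E := integral_nonneg fun ξ ↦ by positivity
  -- Then `κ² E ≤ δ²`, because `E ≤ (E + 1)²`.
  set κ : ℝ := δ / (E + 1) with hκ
  have hκ0 : 0 < κ := by positivity
  set f : Space N → ℂ := fun x ↦ κ * cutoffCoord i x with hf
  have hfd : ContDiff ℝ ∞ f := contDiff_const.mul (contDiff_cutoffCoord i)
  have hfc : HasCompactSupport f := (hasCompactSupport_cutoffCoord i).mul_left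
  set Φ : 𝓢(Space N, ℂ) := hfc.toSchwartzMap hfd with hΦ
  set φ := toC0 f hfd.continuous hfc with hφ
  have hnorm : hsNorm s φ ≤ ENNReal.ofReal δ := by
    refine (hsNorm_le Φ (fun x ↦ rfl)).trans (ENNReal.ofReal_le_ofReal ?_)
    rw [Real.sqrt_le_left hδ.le]
    refine (hsEnergy_le_of_eq_smul (c := κ) (μ := 1) (by linarith) B Φ le_rfl
      (fun x ↦ by rw [one_smul]; rfl)).trans ?_
    rw [Real.one_rpow, mul_one, hκ, div_pow, div_mul_eq_mul_div, div_le_iff₀ (by positivity)]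
    refine mul_le_mul_of_nonneg_left ?_ (by positivity)
    nlinarith
  obtain ⟨hTmax, hreg⟩ := H φ hfd hfc hnorm
  -- The regularity clause concerns solutions up to the maximal time, so one must be produced.
  obtain ⟨u, hu⟩ := exists_isSolutionOn_maximalTime hα hα2 (lam : ℂ) φ
  have hlt : ∀ t : ℝ, t ≤ T / 2 → ENNReal.ofReal t < maximalTime α (lam : ℂ) φ := fun t ht ↦
    lt_of_lt_of_le ((ENNReal.ofReal_lt_ofReal_iff hT).2 (by linarith)) hTmax
  obtain ⟨M, hM⟩ := hu.exists_isMild (half_pos hT).le (hlt _ le_rfl)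
  set v : ℝ → Space N → ℂ := fun t x ↦ u (max 0 (min t (T / 2))) x with hv
  have hM' : IsMild α (lam : ℂ) Φ (T / 2) M v := hM
  obtain ⟨K, hK, hKv⟩ := hM'.norm_sub_le_of_odd hα hα2 i Φ fun x ↦ by
    change (κ : ℂ) * cutoffCoord i (reflectCoord i x) = -(κ * cutoffCoord i x)
    rw [cutoffCoord_reflectCoord, mul_neg]
  set θ := min 1 (η / 12) with hθ
  have hθ0 : 0 < θ := by positivity
  -- On `[0, T₂]` the deviation `K t |xᵢ|` is at most `θ κ |xᵢ|`; the `+ 1` covers `K = 0`.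
  set T₂ := min (T / 2) (θ * κ / (K + 1)) with hT₂
  have hT₂0 : 0 < T₂ := by positivity
  have hKT : ∀ t ∈ Icc 0 T₂, K * t ≤ θ * κ := by
    intro t ht
    have h1 := ht.2.trans (min_le_right _ _)
    rw [le_div_iff₀ (by positivity)] at h1
    nlinarith [ht.1]
  refine hηH hs (A := κ ^ α * κ) hlam hT₂0 (by positivity) (hM'.mono (min_le_left _ _) le_rfl)
    Φ.continuous (fun x ↦ Φ.toBoundedContinuousFunction.norm_coe_le_norm x) ?_ ?_
  · intro t ht x hx
    have h1 := hKv t ⟨ht.1, ht.2.trans (min_le_left _ _)⟩ x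
    have h2 : Φ x = (κ * x i : ℝ) := by
      change (κ : ℂ) * cutoffCoord i x = _
      rw [cutoffCoord_of_norm_le_one i hx, Complex.ofReal_mul]
    rw [h2] at h1
    have h3 : ‖v t x - (κ * x i : ℝ)‖ ≤ θ * (κ * |x i|) := by
      refine h1.trans ?_
      rw [← mul_assoc]
      exact mul_le_mul_of_nonneg_right (hKT t ht) (abs_nonneg _)
    refine (norm_powNl_sub_le_of_norm_sub_le hα hα2 hκ0.le (min_le_left _ _) h3).trans ?_
    have h4 : 12 * θ ≤ η := by linarith [min_le_right 1 (η / 12)]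
    gcongr
  · intro t ht
    have ht' : t ≤ T / 2 := ht.2.trans (min_le_left _ _)
    obtain ⟨B, -, hB⟩ := (hreg u hu t ht.1 (by linarith) (hlt t ht')).exists_bound
    refine ⟨B, fun h ↦ ?_⟩
    have h1 : v t = u t := by simp only [hv, min_eq_left ht', max_eq_right ht.1]
    rw [h1]
    exact hB h

end NLHeat

theorem theorem1p6 (N : ℕ) (α lam : ℝ) (hα : 0 < α) (hα2 : α < 2) (hlam : 0 < lam)
    (hN : (N : ℝ) > 11 + 4 / α) (s : ℝ) (hs : 0 ≤ s) :
    ¬ NLHeat.LocallyWellPosedSmallData N s α (lam : ℂ) := by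
  -- In the second case `s ≥ N/2 - 2/α > 11/2` by the dimension condition.
  rcases lt_or_ge s (N / 2 - 2 / α) with h | h
  · exact NLHeat.not_locallyWellPosed_of_lt hα hlam hs h
  · have h1 : 4 / α = 2 * (2 / α) := by ring
    have hN0 : 0 < N := by
      have : (0 : ℝ) < N := lt_trans (by positivity) hN
      exact_mod_cast this
    exact NLHeat.not_locallyWellPosed_of_ge ⟨0, hN0⟩ hα hα2 hlam (by linarith)
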